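/- Let $f$ be a density on $[0,1]^d$ ($d\ge 1$) which is continuous with $0<\varepsilon\le f\le C<\infty$, and let $(X_i,Y_i)$ be iid, where $X_i\in[0,1]^d$ has density $f$ and $Y_i\in\mathbb{R}$ has a fixed regular conditional distribution given $X_i=z$, to which every expression $\mathbb{E}[\,\cdot\mid X=z]$ below refers. Assume that $z\mapsto\mathbb{E}[Y^2\mid X=z]$ is finite, continuous and bounded on $[0,1]^d$. At stage $n$ the data consist of two disjoint samples $\mathcal I$ and $\mathcal J$ of deterministic sizes $n_{\mathcal I},n_{\mathcal J}=\Theta(n)$, $n_{\mathcal I}\ge 1$, namely the first $n_{\mathcal I}$ and $n_{\mathcal J}$ terms of two independent sequences of such observations; $\mathcal I=\{(X_1,Y_1),\dots,(X_{n_{\mathcal I}},Y_{n_{\mathcal I}})\}$ is used only for prediction and $\mathcal J$ only for determining the splits. Let $\theta$ be an auxiliary random element independent of the data, and let $\boldsymbol W^{\mathcal I}=(W_i)_{i\le n_{\mathcal I}}$ and $\boldsymbol W^{\mathcal J}$ be arrays of bootstrap weights (depending on $n$), non-negative and exchangeable for each $n$, where $\boldsymbol W^{\mathcal I}$, $\boldsymbol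 W^{\mathcal J}$ and ($\theta$, all observations) are independent. A decision tree on $[0,1]^d$, obtained by successive splits $z^j\le c$ versus $z^j>c$ with $c$ in the $j$-th interval of the node, is grown (measurably) from $\theta$, $\mathcal J$ and $\boldsymbol W^{\mathcal J}$. Fix $x\in[0,1]^d$, let $L^*=\prod_{j=1}^d(a_{n,j},b_{n,j}]$ be the leaf into which $x$ falls, $\lambda$ Lebesgue measure, and $$N_L^*=\sum_{i\le n_{\mathcal I}}W_i\mathbf 1\{X_i\in L^*\},\quad N_L^{j,*}=\sum_{i\le n_{\mathcal I}}W_i\mathbf 1\{X_i^j\in(a_{n,j},b_{n,j}]\},\quad T^*(x,\theta)=\sum_{i\le n_{\mathcal I}}\frac{W_i\mathbf 1\{X_i\in L^*\}}{N_L^*}\,Y_i .$$ Write $\mu_n=\mathbb{E}[W_1]$ and let $k_n$ be a deterministic real sequence. Assume: 1. $\sup_n\mu_n<\infty$, $\mathbb{E}[W_1W_2]/\mu_n^2\to1$, and $\mathbb{E}[W_1^2]/\mu_n$ converges to a finite limit. 2. (Minimal node size) Almost surely, $N_L^*\ge k_n$ for all sufficiently large $n$. 3. (Balance) $N_L^{j,*}/(n_{\mathcal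 I}\mu_n)\to0$ almost surely for every $j=1,\dots,d$. 4. $\displaystyle\sum_n\Big(\frac{\mathbb{E}[(W_1/\mu_n)^4]}{n_{\mathcal I}^3}+\frac{\mathbb{E}[(W_1/\mu_n)^2]^2}{n_{\mathcal I}^2}\Big)<\infty$. 5. $\displaystyle\sum_n\frac{n_{\mathcal I}^{4d}}{e^{k_n^2/(8n_{\mathcal I}\mu_n)}}<\infty$, $\displaystyle\sum_n\frac{\mathbb{E}[(W_1-\mu_n)^4]}{k_n^4}n_{\mathcal I}<\infty$, $\displaystyle\sum_n\frac{\mathbb{E}[(W_1-\mu_n)^2]^2}{k_n^4}n_{\mathcal I}^2<\infty$, and $\displaystyle\sum_n e^{-\delta k_n}<\infty$ for every $\delta>0$. 6. There is $c>0$ such that for all $t\in(-c,c)$: $\mathbb{E}[e^{tW_1}]<\infty$ and $\mathbb{E}[e^{tW_1Y_1}\mid X_1=z]<\infty$ for all $n$ and all $z\in[0,1]^d$; $$\sup_n\frac{\mathbb{E}[e^{tW_1}]-1}{\mu_n}<\infty,\qquad \sup_n\frac{\mathbb{E}[e^{tW_1Y_1}\mid X_1=x]-1}{\mu_n}<\infty;$$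 and, almost surely, as $n\to\infty$ (the integrals being well defined for large $n$), $$\frac1{\lambda(L^*)}\int_{L^*}\frac{\mathbb{E}[e^{tW_1Y_1}\mid X_1=z]-1}{\mu_n}f(z)\,dz=\frac{\mathbb{E}[e^{tW_1Y_1}\mid X_1=x]-1}{\mu_n}f(x)+o(1).$$ Then the tree is strongly consistent at $x$: $T^*(x,\theta)\to\mathbb{E}[Y\mid X=x]$ almost surely. -/

import Mathlib

open MeasureTheory ProbabilityTheory Filter Topology Asymptotics

noncomputable section

namespace HonestTree

/-- A half-open box `(lower 1, upper 1] × ⋯ × (lower d, upper d]`, given by its corners. -/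
structure Box (d : ℕ) where
  lower : Fin d → ℝ
  upper : Fin d → ℝ

namespace Box

/-- The root cell `(0, 1]^d`, which is `[0, 1]^d` up to a Lebesgue null set. -/
def unit (d : ℕ) : Box d := ⟨fun _ => 0, fun _ => 1⟩

def toSet {d : ℕ} (B : Box d) : Set (Fin d → ℝ) :=
  {z | ∀ j, z j ∈ Set.Ioc (B.lower j) (B.upper j)}

/-- The side of the box in direction `j`, as a set of real numbers. -/
def side {d : ℕ} (B : Box d) (j : Fin d) : Set ℝ := Set.Ioc (B.lower j) (B.upper j)

/-- The Lebesgue volume of the box. -/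
def vol {d : ℕ} (B : Box d) : ℝ := ∏ j, (B.upper j - B.lower j)

/-- The daughter cell `{z ∈ B : z j ≤ c}`. -/
def left {d : ℕ} (B : Box d) (j : Fin d) (c : ℝ) : Box d :=
  ⟨B.lower, Function.update B.upper j c⟩

/-- The daughter cell `{z ∈ B : z j > c}`. -/
def right {d : ℕ} (B : Box d) (j : Fin d) (c : ℝ) : Box d :=
  ⟨Function.update B.lower j c, B.upper⟩

end Box

/-- Decision trees with binary splits on single features. -/
inductive SplitTree (d : ℕ) where
  | leaf : SplitTree d
  | node (j : Fin d) (c : ℝ) (l r : SplitTree d) : SplitTree d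

namespace SplitTree

/-- The leaf cell into which `x` falls, when the tree partitions the cell `B`. -/
def leafBox {d : ℕ} (x : Fin d → ℝ) : SplitTree d → Box d → Box d
  | leaf, B => B
  | node j c l r, B =>
      if x j ≤ c then leafBox x l (B.left j c) else leafBox x r (B.right j c)

/-- Every threshold lies in the `j`-th interval of the node that it splits. -/
def Admissible {d : ℕ} : SplitTree d → Box d → Prop
  | leaf, _ => True
  | node j c l r, B =>
      c ∈ B.side j ∧ Admissible l (B.left j c) ∧ Admissible r (B.right j c)

end SplitTree

/-- The data of a sequence (indexed by the stage `n`) of bootstrap honest trees. At stage `n`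
the prediction sample `𝓘` consists of the first `nI n` terms of `ZI`, and the sample `𝓙` that
determines the splits consists of the first `nJ n` terms of `ZJ`; an observation is a pair
(covariates, response). `WI n i`, `i < nI n`, and `WJ n i`, `i < nJ n`, are the bootstrap weights
of the two samples (other values of the index `i` are never used), `θ` is the auxiliary
randomness, and `grow n` is the rule that builds the tree from `θ`, the sample `𝓙` and the
weights of `𝓙`. -/
structure BootstrapTree (Ω Θ : Type*) (d : ℕ) where
  nI : ℕ → ℕ
  nJ : ℕ → ℕ
  ZI : ℕ → Ω → (Fin d → ℝ) × ℝ
  ZJ : ℕ → Ω → (Fin d → ℝ) × ℝ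
  WI : ℕ → ℕ → Ω → ℝ
  WJ : ℕ → ℕ → Ω → ℝ
  θ : Ω → Θ
  grow : (n : ℕ) → Θ → (Fin (nJ n) → (Fin d → ℝ) × ℝ) → (Fin (nJ n) → ℝ) → SplitTree d

namespace BootstrapTree

variable {Ω Θ : Type*} {d : ℕ}

/-- The leaf `L*(x, θ)` at stage `n`. -/
def leaf (T : BootstrapTree Ω Θ d) (x : Fin d → ℝ) (n : ℕ) (ω : Ω) : Box d :=
  (T.grow n (T.θ ω) (fun i => T.ZJ i ω) (fun i => T.WJ n i ω)).leafBox x (Box.unit d)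

/-- `N_L*(x, θ)`: the weighted number of prediction observations in the leaf of `x`. -/
def leafCount (T : BootstrapTree Ω Θ d) (x : Fin d → ℝ) (n : ℕ) (ω : Ω) : ℝ :=
  ∑ i ∈ Finset.range (T.nI n),
    T.WI n i ω * (T.leaf x n ω).toSet.indicator (fun _ => (1 : ℝ)) (T.ZI i ω).1

/-- `N_L^{j,*}(x, θ)`: the weighted number of prediction observations whose `j`-th coordinate
falls into the `j`-th interval of the leaf of `x`. -/
def sideCount (T : BootstrapTree Ω Θ d) (x : Fin d → ℝ) (j : Fin d) (n : ℕ) (ω : Ω) : ℝ :=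
  ∑ i ∈ Finset.range (T.nI n),
    T.WI n i ω * ((T.leaf x n ω).side j).indicator (fun _ => (1 : ℝ)) ((T.ZI i ω).1 j)

/-- The tree predictor `T*(x, θ)` at stage `n`. -/
def predict (T : BootstrapTree Ω Θ d) (x : Fin d → ℝ) (n : ℕ) (ω : Ω) : ℝ :=
  ∑ i ∈ Finset.range (T.nI n),
    T.WI n i ω * (T.leaf x n ω).toSet.indicator (fun _ => (1 : ℝ)) (T.ZI i ω).1
      / T.leafCount x n ω * (T.ZI i ω).2

/-- All observations, those for prediction and those for growing. -/
def observations (T : BootstrapTree Ω Θ d) (ω : Ω) :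
    (ℕ → (Fin d → ℝ) × ℝ) × (ℕ → (Fin d → ℝ) × ℝ) :=
  (fun i => T.ZI i ω, fun i => T.ZJ i ω)

/-- The array of all weights of the prediction samples. -/
def weightsI (T : BootstrapTree Ω Θ d) (ω : Ω) : (n : ℕ) → Fin (T.nI n) → ℝ :=
  fun n i => T.WI n i ω

/-- The array of all weights of the samples that determine the splits. -/
def weightsJ (T : BootstrapTree Ω Θ d) (ω : Ω) : (n : ℕ) → Fin (T.nJ n) → ℝ :=
  fun n i => T.WJ n i ω

end BootstrapTree

/-- The law of `(X, Y)`, where `X` has the density `f` on `[0, 1]^d` and `κ z` is the conditional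
law of `Y` given `X = z`. -/
def jointLaw {d : ℕ} (f : (Fin d → ℝ) → ℝ) (κ : Kernel (Fin d → ℝ) ℝ) :
    Measure ((Fin d → ℝ) × ℝ) :=
  ((volume.restrict (Set.Icc 0 1)).withDensity (fun z => ENNReal.ofReal (f z))) ⊗ₘ κ

/-- The covariate assumption: the density is continuous and bounded away from zero and infinity,
and the conditional second moment of the response is continuous and bounded. -/
structure CovariateAssumption {d : ℕ} (f : (Fin d → ℝ) → ℝ) (κ : Kernel (Fin d → ℝ) ℝ) :
    Prop where
  continuous_density : ContinuousOn f (Set.Icc 0 1)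
  bounds : ∃ ε C : ℝ, 0 < ε ∧ ∀ z ∈ Set.Icc (0 : Fin d → ℝ) 1, ε ≤ f z ∧ f z ≤ C
  integrable_sq : ∀ z ∈ Set.Icc (0 : Fin d → ℝ) 1, Integrable (fun y : ℝ => y ^ 2) (κ z)
  continuous_sq : ContinuousOn (fun z => ∫ y, y ^ 2 ∂(κ z)) (Set.Icc 0 1)
  bounded_sq : ∃ K : ℝ, ∀ z ∈ Set.Icc (0 : Fin d → ℝ) 1, ∫ y, y ^ 2 ∂(κ z) ≤ K

/-- Exchangeability of a finite family of real random variables. -/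
def Exchangeable {Ω : Type*} [MeasurableSpace Ω] (P : Measure Ω) {m : ℕ}
    (W : Fin m → Ω → ℝ) : Prop :=
  ∀ σ : Equiv.Perm (Fin m),
    P.map (fun ω (i : Fin m) => W (σ i) ω) = P.map (fun ω (i : Fin m) => W i ω)

namespace BootstrapTree

variable {Ω Θ : Type*} [MeasurableSpace Ω] [MeasurableSpace Θ] {d : ℕ}

/-- The observations are iid with law `jointLaw f κ`, the sizes of the two (disjoint) samples are
deterministic and of order `n`, the auxiliary randomness is independent of the observations, and
the tree is grown by splits on single features from `θ`, the sample `𝓙` and its weights only,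
in a measurable way. -/
structure Honest (T : BootstrapTree Ω Θ d) (P : Measure Ω) (f : (Fin d → ℝ) → ℝ)
    (κ : Kernel (Fin d → ℝ) ℝ) : Prop where
  nI_pos : ∀ n, 0 < T.nI n
  nI_theta : (fun n => (T.nI n : ℝ)) =Θ[atTop] (fun n : ℕ => (n : ℝ))
  nJ_theta : (fun n => (T.nJ n : ℝ)) =Θ[atTop] (fun n : ℕ => (n : ℝ))
  measurable_ZI : ∀ i, Measurable (T.ZI i)
  measurable_ZJ : ∀ i, Measurable (T.ZJ i)
  measurable_θ : Measurable T.θ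
  law_ZI : ∀ i, P.map (T.ZI i) = jointLaw f κ
  law_ZJ : ∀ i, P.map (T.ZJ i) = jointLaw f κ
  indep_observations : iIndepFun (Sum.elim T.ZI T.ZJ) P
  indep_θ : IndepFun T.θ T.observations P
  admissible : ∀ n t z w, (T.grow n t z w).Admissible (Box.unit d)
  measurable_lower : ∀ n, ∀ x ∈ Set.Icc (0 : Fin d → ℝ) 1, ∀ j, Measurable
    (fun q : Θ × (Fin (T.nJ n) → (Fin d → ℝ) × ℝ) × (Fin (T.nJ n) → ℝ) =>
      ((T.grow n q.1 q.2.1 q.2.2).leafBox x (Box.unit d)).lower j)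
  measurable_upper : ∀ n, ∀ x ∈ Set.Icc (0 : Fin d → ℝ) 1, ∀ j, Measurable
    (fun q : Θ × (Fin (T.nJ n) → (Fin d → ℝ) × ℝ) × (Fin (T.nJ n) → ℝ) =>
      ((T.grow n q.1 q.2.1 q.2.2).leafBox x (Box.unit d)).upper j)

/-- The expected weight `E[W₁]` of a prediction observation at stage `n`. -/
def meanWeight (T : BootstrapTree Ω Θ d) (P : Measure Ω) (n : ℕ) : ℝ := ∫ ω, T.WI n 0 ω ∂P

/-- The requirements on the bootstrap weights, apart from those on the splits: non-negative and
exchangeable within each sample, the two families of weights independent of each other and of the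
observations and `θ`, and the conditions on the first and second moments. -/
structure WeightAssumption (T : BootstrapTree Ω Θ d) (P : Measure Ω) : Prop where
  measurable_WI : ∀ n, ∀ i < T.nI n, Measurable (T.WI n i)
  measurable_WJ : ∀ n, ∀ i < T.nJ n, Measurable (T.WJ n i)
  nonneg_WI : ∀ n, ∀ i < T.nI n, ∀ᵐ ω ∂P, 0 ≤ T.WI n i ω
  nonneg_WJ : ∀ n, ∀ i < T.nJ n, ∀ᵐ ω ∂P, 0 ≤ T.WJ n i ω
  exchangeable_WI : ∀ n, Exchangeable P (fun i : Fin (T.nI n) => T.WI n i)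
  exchangeable_WJ : ∀ n, Exchangeable P (fun i : Fin (T.nJ n) => T.WJ n i)
  indep_WJ : IndepFun T.weightsJ (fun ω => (T.θ ω, T.observations ω)) P
  indep_WI : IndepFun T.weightsI (fun ω => (T.weightsJ ω, T.θ ω, T.observations ω)) P
  bounded_mean : BddAbove (Set.range (T.meanWeight P))
  mixed_moment : Tendsto
    (fun n => (∫ ω, T.WI n 0 ω * T.WI n 1 ω ∂P) / (T.meanWeight P n) ^ 2) atTop (𝓝 1)
  second_moment : ∃ L : ℝ, Tendsto
    (fun n => (∫ ω, (T.WI n 0 ω) ^ 2 ∂P) / T.meanWeight P n) atTop (𝓝 L)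

/-- The summability condition on the fourth and second moments of `W₁ / E[W₁]`. -/
def SummableAdjustedMoments (T : BootstrapTree Ω Θ d) (P : Measure Ω) : Prop :=
  Summable (fun n =>
    (∫ ω, (T.WI n 0 ω / T.meanWeight P n) ^ 4 ∂P) / (T.nI n : ℝ) ^ 3
      + (∫ ω, (T.WI n 0 ω / T.meanWeight P n) ^ 2 ∂P) ^ 2 / (T.nI n : ℝ) ^ 2)

/-- The summability conditions that relate the minimal leaf sizes `k` to the sample size and
to the central moments of the weights. -/
structure SummableLeafSize (T : BootstrapTree Ω Θ d) (P : Measure Ω) (k : ℕ → ℝ) : Prop where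
  exponential : Summable (fun n =>
    (T.nI n : ℝ) ^ (4 * d) / Real.exp (k n ^ 2 / (8 * T.nI n * T.meanWeight P n)))
  fourth : Summable (fun n =>
    (∫ ω, (T.WI n 0 ω - T.meanWeight P n) ^ 4 ∂P) / k n ^ 4 * T.nI n)
  second : Summable (fun n =>
    (∫ ω, (T.WI n 0 ω - T.meanWeight P n) ^ 2 ∂P) ^ 2 / k n ^ 4 * (T.nI n : ℝ) ^ 2)

/-- `E[exp (t W₁ Y₁) | X₁ = z]` at stage `n`: as the weights are independent of the observations,
the conditional law of `(W₁, Y₁)` given `X₁ = z` is the product of the law of `W₁` and `κ z`. -/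
def condMGF (T : BootstrapTree Ω Θ d) (P : Measure Ω) (κ : Kernel (Fin d → ℝ) ℝ)
    (n : ℕ) (t : ℝ) (z : Fin d → ℝ) : ℝ :=
  ∫ q : Ω × ℝ, Real.exp (t * T.WI n 0 q.1 * q.2) ∂(P.prod (κ z))

/-- The requirements on the moment generating functions of `W₁` and of `W₁ Y₁` given `X₁ = z`, on
the neighbourhood `(-c, c)` of zero: they are finite, `(E[exp (t W₁)] - 1) / E[W₁]` and
`(E[exp (t W₁ Y₁) | X₁ = x] - 1) / E[W₁]` are bounded in `n`, and the averages of
`(E[exp (t W₁ Y₁) | X₁ = z] - 1) / E[W₁] * f z` over `z` in the leaf of `x` differ by `o(1)`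
from the value at `x`, almost surely. -/
structure MGFAssumption (T : BootstrapTree Ω Θ d) (P : Measure Ω) (f : (Fin d → ℝ) → ℝ)
    (κ : Kernel (Fin d → ℝ) ℝ) (x : Fin d → ℝ) (c : ℝ) : Prop where
  exists_weight : ∀ n, ∀ t ∈ Set.Ioo (-c) c, Integrable (fun ω => Real.exp (t * T.WI n 0 ω)) P
  exists_response : ∀ n, ∀ t ∈ Set.Ioo (-c) c, ∀ z ∈ Set.Icc (0 : Fin d → ℝ) 1,
    Integrable (fun q : Ω × ℝ => Real.exp (t * T.WI n 0 q.1 * q.2)) (P.prod (κ z))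
  bounded_weight : ∀ t ∈ Set.Ioo (-c) c,
    BddAbove (Set.range fun n => (mgf (T.WI n 0) P t - 1) / T.meanWeight P n)
  bounded_response : ∀ t ∈ Set.Ioo (-c) c,
    BddAbove (Set.range fun n => (T.condMGF P κ n t x - 1) / T.meanWeight P n)
  average : ∀ t ∈ Set.Ioo (-c) c, ∀ᵐ ω ∂P,
    (∀ᶠ n in atTop, IntegrableOn
      (fun z => (T.condMGF P κ n t z - 1) / T.meanWeight P n * f z) (T.leaf x n ω).toSet) ∧
    Tendsto (fun n =>
      1 / (T.leaf x n ω).vol *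
          (∫ z in (T.leaf x n ω).toSet, (T.condMGF P κ n t z - 1) / T.meanWeight P n * f z)
        - (T.condMGF P κ n t x - 1) / T.meanWeight P n * f x) atTop (𝓝 0)

end BootstrapTree

end HonestTree

end

namespace HonestTree

/-! ### Elementary inequalities -/

/-! The leaf is a function of the splitting data alone, hence independent of the prediction sample
and its weights. By Fubini the corners can be frozen, and it suffices to treat a deterministic
sequence of boxes `B n` around `x` (`ae_tendsto_predict_of_forall_boxes`).

For such boxes there is a bias and a fluctuation to control. The balance condition, passed to means
by uniform integrability, forces every side of `B n` to zero, so the density is nearly constant on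
the box. Continuity of the conditional mean is not assumed. It is replaced by the averaging
condition on the conditional moment generating functions: `exp u ≥ 1 + u` bounds `t` times the mean
response over the box by the averaged transform, which is close to the transform at `x`, which in
turn is `1 + t μ E[Y | X = x] + O(t² μ)`. Dividing by a small `t` of either sign gives
`eventually_setIntegral_condMean_le`.

For the fluctuation, a deviation of the leaf mean by `δ` while the leaf count is at least `k` makes
a weighted sum of iid terms exceed `δ k / 4`, although each term has mean at most `-(δ / 2) p` and
second moment `O(p)`, where `p` is the mass of the box. Given the weights, either one summand is of
order `k`, or the sum of truncated summands is large. A Chernoff bound, whose parameter does not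
depend on `p` because drift and variance both scale with `p`, makes the latter a negative fourth
power of `k` times the fourth power of the largest weight (`measure_random_weighted_sum_ge_le`).
Single large summands are handled by exponential moments of `W Y` and fourth moments of `W`
(`measure_deviation_le`). The bounds are summable, and Borel–Cantelli finishes the proof
(`ae_tendsto_boxMean`). -/

theorem exp_le_one_add_self_add_sq_mul_exp {u b : ℝ} (hub : u ≤ b) (hb : 0 ≤ b) :
    Real.exp u ≤ 1 + u + u ^ 2 * Real.exp b := by
  have h1 : 1 ≤ Real.exp b := Real.one_le_exp hb
  -- For `u ≥ 0` this inequality multiplied by `u` gives the claim; for `u ≤ 0` it yields `exp u ≤ 1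
  -- + u + u ^ 2`.
  have h2 : Real.exp u - 1 ≤ u * Real.exp u := by
    have := Real.add_one_le_exp (-u)
    have h3 : Real.exp u * Real.exp (-u) = 1 := by rw [← Real.exp_add]; simp
    nlinarith [Real.exp_pos u]
  rcases le_total 0 u with hu | hu
  · have h3 : Real.exp u ≤ Real.exp b := Real.exp_le_exp.2 hub
    have h4 : u * (Real.exp u - 1) ≤ u * (u * Real.exp u) := mul_le_mul_of_nonneg_left h2 hu
    have h5 : u ^ 2 * Real.exp u ≤ u ^ 2 * Real.exp b :=
      mul_le_mul_of_nonneg_left h3 (sq_nonneg u)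
    nlinarith
  · have h3 := Real.add_one_le_exp u
    have h4 : -u * (1 - Real.exp u) ≤ -u * -u :=
      mul_le_mul_of_nonneg_left (by linarith) (by linarith)
    have h5 : u ^ 2 * 1 ≤ u ^ 2 * Real.exp b := mul_le_mul_of_nonneg_left h1 (sq_nonneg u)
    nlinarith

theorem abs_min_le_abs {v y : ℝ} (hy : 0 ≤ y) : |min v y| ≤ |v| := by
  rcases le_total v y with h | h
  · rw [min_eq_left h]
  · rw [min_eq_right h, abs_of_nonneg hy]
    exact h.trans (le_abs_self v)

theorem sq_min_le_sq {v y : ℝ} (hy : 0 ≤ y) : min v y ^ 2 ≤ v ^ 2 :=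
  sq_le_sq.2 (abs_min_le_abs hy)

theorem add_pow_four_le {a b : ℝ} : (a + b) ^ 4 ≤ 8 * a ^ 4 + 8 * b ^ 4 := by
  nlinarith [sq_nonneg (a ^ 2 - b ^ 2), sq_nonneg (a - b), sq_nonneg (a + b),
    mul_nonneg (sq_nonneg (a - b)) (sq_nonneg (a - b)),
    mul_nonneg (sq_nonneg (a - b)) (sq_nonneg (a + b)), sq_nonneg (a * b), sq_nonneg (a ^ 2 + b ^ 2)]

/-! ### A large deviation bound for weighted sums -/

section WeightedSums

variable {Ω E : Type*} [MeasurableSpace Ω] [MeasurableSpace E] {P : Measure Ω}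
  [IsProbabilityMeasure P]

/-- The moment generating function of a random variable with negative drift, truncated above, is
at most one, provided that the parameter is small enough. -/
theorem mgf_min_le_one {ν : Measure E} [IsProbabilityMeasure ν] {g : E → ℝ}
    (hg1 : Integrable g ν) (hg2 : Integrable (fun e => g e ^ 2) ν) {p C ρ A y w s : ℝ}
    (hp : 0 ≤ p) (hy : 0 ≤ y) (hs : 0 ≤ s)
    (hm : ∫ e, g e ∂ν ≤ -(ρ * p)) (hv : ∫ e, g e ^ 2 ∂ν ≤ C * p) (hw : 0 ≤ w) (hwA : w ≤ A)
    (hsm : s * (A * C * Real.exp (s * y)) ≤ ρ) :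
    mgf (fun e => min (w * g e) y) ν s ≤ 1 := by
  have hle : ∀ e, Real.exp (s * min (w * g e) y)
      ≤ 1 + s * (w * g e) + s ^ 2 * (w ^ 2 * g e ^ 2) * Real.exp (s * y) := by
    intro e
    have h1 := exp_le_one_add_self_add_sq_mul_exp (u := s * min (w * g e) y) (b := s * y)
      (mul_le_mul_of_nonneg_left (min_le_right _ _) hs) (mul_nonneg hs hy)
    have h2 : s * min (w * g e) y ≤ s * (w * g e) :=
      mul_le_mul_of_nonneg_left (min_le_left _ _) hs
    have h3 : (s * min (w * g e) y) ^ 2 ≤ s ^ 2 * (w ^ 2 * g e ^ 2) := by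
      rw [mul_pow, ← mul_pow w]
      exact mul_le_mul_of_nonneg_left (sq_min_le_sq hy) (sq_nonneg s)
    have h4 := mul_le_mul_of_nonneg_right h3 (Real.exp_pos (s * y)).le
    linarith
  have hint : Integrable (fun e => 1 + s * (w * g e) + s ^ 2 * (w ^ 2 * g e ^ 2)
      * Real.exp (s * y)) ν :=
    ((integrable_const 1).add ((hg1.const_mul w).const_mul s)).add
      (((hg2.const_mul (w ^ 2)).const_mul (s ^ 2)).mul_const _)
  have h1 : mgf (fun e => min (w * g e) y) ν s
      ≤ ∫ e, (1 + s * (w * g e) + s ^ 2 * (w ^ 2 * g e ^ 2) * Real.exp (s * y)) ∂ν :=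
    integral_mono_of_nonneg (ae_of_all _ fun e => (Real.exp_pos _).le) hint (ae_of_all _ hle)
  have h2 : ∫ e, (1 + s * (w * g e) + s ^ 2 * (w ^ 2 * g e ^ 2) * Real.exp (s * y)) ∂ν
      = 1 + s * (w * ∫ e, g e ∂ν) + s ^ 2 * (w ^ 2 * ∫ e, g e ^ 2 ∂ν) * Real.exp (s * y) := by
    rw [integral_add (by fun_prop) (((hg2.const_mul (w ^ 2)).const_mul (s ^ 2)).mul_const _),
      integral_add (by fun_prop) (by fun_prop), integral_mul_const, integral_const_mul,
      integral_const_mul, integral_const_mul, integral_const_mul]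
    simp
  rw [h2] at h1
  have h3 : s * (w * ∫ e, g e ∂ν) ≤ s * (w * -(ρ * p)) := by gcongr
  -- Replacing only one factor `w` by `A` leaves the common factor `s * w * p` in the linear and the
  -- quadratic term, so the condition on `s` involves neither `w` nor `p`.
  have h4 : s ^ 2 * (w ^ 2 * ∫ e, g e ^ 2 ∂ν) * Real.exp (s * y)
      ≤ s ^ 2 * (w * A * (C * p)) * Real.exp (s * y) := by
    have : w ^ 2 ≤ w * A := by rw [sq]; gcongr
    have h0 : 0 ≤ ∫ e, g e ^ 2 ∂ν := integral_nonneg fun e => sq_nonneg _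
    have h0' : 0 ≤ w * A := mul_nonneg hw (hw.trans hwA)
    gcongr
  have h5 : s * w * p * (s * (A * C * Real.exp (s * y))) ≤ s * w * p * ρ := by gcongr
  nlinarith

/-- Single-big-jump principle: unless one summand exceeds an eighth of the level, the sum equals the
sum of its truncations, to which Chernoff applies. The bound depends neither on the number of
summands nor on `p`, except through the single jumps. -/
theorem measure_weighted_sum_ge_le {ι : Type*} [Fintype ι] {Z : ι → Ω → E}
    (hZ : ∀ i, Measurable (Z i)) (hind : iIndepFun Z P) {ν : Measure E} [IsProbabilityMeasure ν]
    (hlaw : ∀ i, P.map (Z i) = ν) {g : E → ℝ} (hg : Measurable g) (hg1 : Integrable g ν)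
    (hg2 : Integrable (fun e => g e ^ 2) ν) {p C ρ A k β : ℝ} (hp : 0 ≤ p) (hC : 0 < C)
    (hρ : 0 < ρ) (hA : 0 < A) (hk : 0 < k) (hβ : 0 < β)
    (hm : ∫ e, g e ∂ν ≤ -(ρ * p)) (hv : ∫ e, g e ^ 2 ∂ν ≤ C * p)
    {w : ι → ℝ} (hw : ∀ i, 0 ≤ w i) (hwA : ∀ i, w i ≤ A) :
    P {ω | β * k ≤ ∑ i, w i * g (Z i ω)}
      ≤ ∑ i, P {ω | β / 8 * k < w i * g (Z i ω)}
        + ENNReal.ofReal ((C / (ρ * (β / 8) * k)) ^ 4 * A ^ 4) := by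
  set y : ℝ := β / 8 * k with hy
  have hy0 : 0 < y := by positivity
  -- In the first case the last term of the bound is at least one.
  rcases le_or_gt (ρ * y) (A * C) with hD | hD
  · have h1 : 1 ≤ (C / (ρ * (β / 8) * k)) ^ 4 * A ^ 4 := by
      rw [← mul_pow]
      apply one_le_pow₀
      rw [div_mul_eq_mul_div, one_le_div (by positivity)]
      calc ρ * (β / 8) * k = ρ * y := by rw [hy]; ring
        _ ≤ C * A := by linarith
    calc _ ≤ (1 : ENNReal) := prob_le_one
      _ ≤ ENNReal.ofReal ((C / (ρ * (β / 8) * k)) ^ 4 * A ^ 4) := by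
          rwa [ENNReal.one_le_ofReal]
      _ ≤ _ := le_add_self
  set D2 : ℝ := ρ * y / (A * C) with hD2
  have hD2' : 1 < D2 := by rw [hD2, one_lt_div (by positivity)]; exact hD
  -- The square root makes `s = log D / y` admissible: `exp (s * y) = D` and `D * log D ≤ D ^ 2 =
  -- D2`. As the level is `8 * y`, the Chernoff factor is `D ^ (-8) = D2 ^ (-4)`, which produces the
  -- fourth power of `A` that fourth moments of the weights can absorb.
  set D : ℝ := Real.sqrt D2 with hDdef
  have hDsq : D ^ 2 = D2 := Real.sq_sqrt (by positivity)
  have hD1 : 1 < D := by rw [hDdef]; exact Real.lt_sqrt_of_sq_lt (by simpa using hD2')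
  have hD0 : 0 < D := by linarith
  set s : ℝ := Real.log D / y with hs
  have hlog : 0 < Real.log D := Real.log_pos hD1
  have hs0 : 0 < s := by positivity
  have hsy : s * y = Real.log D := by rw [hs]; field_simp
  have hexp : Real.exp (s * y) = D := by rw [hsy, Real.exp_log hD0]
  have hsm : s * (A * C * Real.exp (s * y)) ≤ ρ := by
    rw [hexp]
    have h1 : Real.log D ≤ D := (Real.log_le_sub_one_of_pos hD0).trans (by linarith)
    have h2 : Real.log D * D ≤ D2 := by rw [← hDsq, sq]; gcongr
    have h3 : Real.log D * D * (A * C) ≤ ρ * y := by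
      rw [hD2, le_div_iff₀ (by positivity)] at h2; exact h2
    rw [hs, div_mul_eq_mul_div, div_le_iff₀ hy0]
    linarith
  set V : ι → Ω → ℝ := fun i ω => min (w i * g (Z i ω)) y with hV
  have hVm : ∀ i, Measurable (V i) := fun i =>
    ((hg.comp (hZ i)).const_mul (w i)).min measurable_const
  have hVind : iIndepFun V P :=
    hind.comp (fun i e => min (w i * g e) y) fun i => (hg.const_mul (w i)).min measurable_const
  have hVmgf : ∀ i, mgf (V i) P s ≤ 1 := by
    intro i
    have h1 : mgf (V i) P s = mgf (fun e => min (w i * g e) y) ν s := by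
      rw [← hlaw i, mgf_map (hZ i).aemeasurable]
      · rfl
      · exact (Measurable.aestronglyMeasurable
          (((hg.const_mul (w i)).min measurable_const).const_mul s).exp)
    rw [h1]
    exact mgf_min_le_one hg1 hg2 hp hy0.le hs0.le hm hv (hw i) (hwA i) hsm
  have hsub : {ω | β * k ≤ ∑ i, w i * g (Z i ω)}
      ⊆ (⋃ i, {ω | y < w i * g (Z i ω)}) ∪ {ω | β * k ≤ (∑ i, V i) ω} := by
    intro ω hω
    by_cases h : ∃ i, y < w i * g (Z i ω)
    · exact Or.inl (Set.mem_iUnion.2 h)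
    · push Not at h
      right
      simp only [Set.mem_ofPred_eq, Finset.sum_apply] at hω ⊢
      refine hω.trans (le_of_eq (Finset.sum_congr rfl fun i _ => ?_))
      exact (min_eq_left (h i)).symm
  have hbd : ∀ ω, (∑ i, V i) ω ≤ ∑ _i : ι, y := by
    intro ω
    rw [Finset.sum_apply]
    exact Finset.sum_le_sum fun i _ => min_le_right _ _
  have hint : Integrable (fun ω => Real.exp (s * (∑ i, V i) ω)) P := by
    refine Integrable.of_bound ?_ (Real.exp (s * ∑ _i : ι, y)) (ae_of_all _ fun ω => ?_)
    · have hVs : Measurable (∑ i, V i) := by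
        rw [show (∑ i, V i) = fun ω => ∑ i, V i ω by ext; simp]
        exact Finset.measurable_sum _ fun i _ => hVm i
      exact (hVs.const_mul s).exp.aestronglyMeasurable
    · rw [Real.norm_eq_abs, abs_of_pos (Real.exp_pos _)]
      exact Real.exp_le_exp.2 (mul_le_mul_of_nonneg_left (hbd ω) hs0.le)
  have hcher : P {ω | β * k ≤ (∑ i, V i) ω}
      ≤ ENNReal.ofReal ((C / (ρ * (β / 8) * k)) ^ 4 * A ^ 4) := by
    have h1 := measure_ge_le_exp_mul_mgf (β * k) hs0.le hint
    rw [hVind.mgf_sum hVm] at h1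
    have h2 : ∏ i, mgf (V i) P s ≤ 1 :=
      Finset.prod_le_one (fun i _ => mgf_nonneg) fun i _ => hVmgf i
    have h3 : Real.exp (-s * (β * k)) = (C / (ρ * (β / 8) * k)) ^ 4 * A ^ 4 := by
      have : -s * (β * k) = -(8 : ℕ) * Real.log D := by
        rw [← hsy, hy]; push_cast; ring
      rw [this, neg_mul, Real.exp_neg, Real.exp_nat_mul, Real.exp_log hD0,
        show D ^ 8 = (D ^ 2) ^ 4 by ring, hDsq, hD2, ← mul_pow, ← inv_pow, inv_div, hy]
      congr 1
      ring
    rw [← ENNReal.ofReal_toReal (measure_ne_top P _)]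
    apply ENNReal.ofReal_le_ofReal
    rw [← h3]
    refine h1.trans ?_
    exact mul_le_of_le_one_right (Real.exp_pos _).le h2
  calc P {ω | β * k ≤ ∑ i, w i * g (Z i ω)}
      ≤ P ((⋃ i, {ω | y < w i * g (Z i ω)}) ∪ {ω | β * k ≤ (∑ i, V i) ω}) := measure_mono hsub
    _ ≤ P (⋃ i, {ω | y < w i * g (Z i ω)}) + P {ω | β * k ≤ (∑ i, V i) ω} :=
        measure_union_le _ _
    _ ≤ _ := add_le_add (measure_iUnion_fintype_le _ _) hcher

/-! ### Independence and Fubini -/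

theorem measure_prodMk_mem_of_indepFun {F : Type*} [MeasurableSpace F] {U : Ω → E} {V : Ω → F}
    (hU : Measurable U) (hV : Measurable V) (h : IndepFun U V P) {S : Set (E × F)}
    (hS : MeasurableSet S) :
    P {ω | (U ω, V ω) ∈ S} = ∫⁻ ω, P {ω' | (U ω, V ω') ∈ S} ∂P := by
  have h1 := (indepFun_iff_map_prod_eq_prod_map_map hU.aemeasurable hV.aemeasurable).1 h
  have h2 : P {ω | (U ω, V ω) ∈ S} = (P.map fun ω => (U ω, V ω)) S := by
    rw [Measure.map_apply (hU.prodMk hV) hS]; rfl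
  have : IsProbabilityMeasure (P.map V) := Measure.isProbabilityMeasure_map hV.aemeasurable
  rw [h2, h1, Measure.prod_apply hS, lintegral_map (measurable_measure_prodMk_left hS) hU]
  refine lintegral_congr fun ω => ?_
  rw [Measure.map_apply hV (measurable_prodMk_left hS)]
  rfl

/-- Both directions serve the freezing of the leaf: hypotheses pass to almost every fixed leaf, and
the conclusion passes back. -/
theorem ae_prodMk_mem_iff_of_indepFun {F : Type*} [MeasurableSpace F] {U : Ω → E} {V : Ω → F}
    (hU : Measurable U) (hV : Measurable V) (h : IndepFun U V P) {S : Set (E × F)}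
    (hS : MeasurableSet S) :
    (∀ᵐ ω ∂P, (U ω, V ω) ∈ S) ↔ ∀ᵐ ω ∂P, ∀ᵐ ω' ∂P, (U ω, V ω') ∈ S := by
  have hSc := hS.compl
  have hm : Measurable fun ω => P {ω' | (U ω, V ω') ∈ Sᶜ} := by
    have h1 := (measurable_measure_prodMk_left (ν := P.map V) hSc).comp hU
    convert h1 using 2 with ω
    simp only [Function.comp]
    rw [Measure.map_apply hV (measurable_prodMk_left hSc)]
    rfl
  have h1 := measure_prodMk_mem_of_indepFun hU hV h hSc
  rw [ae_iff]
  have h2 : {ω | ¬ (U ω, V ω) ∈ S} = {ω | (U ω, V ω) ∈ Sᶜ} := rfl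
  rw [h2, h1, lintegral_eq_zero_iff hm]
  exact Iff.rfl

/-- The joint law of the triple is a product of three laws, and products of measures are
associative. -/
theorem IndepFun.prodMk_left_of_prodMk_right {F G : Type*} [MeasurableSpace F]
    [MeasurableSpace G] {A : Ω → E} {B : Ω → F} {C : Ω → G} (hA : Measurable A)
    (hB : Measurable B) (hC : Measurable C) (h : IndepFun A (fun ω => (B ω, C ω)) P)
    (h' : IndepFun B C P) : IndepFun (fun ω => (A ω, B ω)) C P := by
  have : IsProbabilityMeasure (P.map A) := Measure.isProbabilityMeasure_map hA.aemeasurable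
  have : IsProbabilityMeasure (P.map B) := Measure.isProbabilityMeasure_map hB.aemeasurable
  have : IsProbabilityMeasure (P.map C) := Measure.isProbabilityMeasure_map hC.aemeasurable
  have hAB : IndepFun A B P := h.comp measurable_id measurable_fst
  rw [indepFun_iff_map_prod_eq_prod_map_map hA.aemeasurable (hB.prodMk hC).aemeasurable,
    (indepFun_iff_map_prod_eq_prod_map_map hB.aemeasurable hC.aemeasurable).1 h'] at h
  rw [indepFun_iff_map_prod_eq_prod_map_map (hA.prodMk hB).aemeasurable hC.aemeasurable,
    (indepFun_iff_map_prod_eq_prod_map_map hA.aemeasurable hB.aemeasurable).1 hAB]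
  have h3 : P.map (fun ω => ((A ω, B ω), C ω))
      = (P.map fun ω => (A ω, B ω, C ω)).map MeasurableEquiv.prodAssoc.symm := by
    rw [Measure.map_map (by fun_prop) (by fun_prop)]
    rfl
  rw [h3, h]
  exact (MeasurePreserving.map_eq (measurePreserving_prodAssoc _ _ _).symm)

/-- The large deviation bound for random weights that are independent of the observations. -/
theorem measure_random_weighted_sum_ge_le {ι : Type*} [Fintype ι] {Z : ι → Ω → E}
    (hZ : ∀ i, Measurable (Z i)) (hind : iIndepFun Z P) {ν : Measure E} [IsProbabilityMeasure ν]
    (hlaw : ∀ i, P.map (Z i) = ν) {g : E → ℝ} (hg : Measurable g) (hg1 : Integrable g ν)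
    (hg2 : Integrable (fun e => g e ^ 2) ν) {p C ρ k β μ : ℝ} (hp : 0 ≤ p) (hC : 0 < C)
    (hρ : 0 < ρ) (hk : 0 < k) (hβ : 0 < β) (hμ : 0 < μ)
    (hm : ∫ e, g e ∂ν ≤ -(ρ * p)) (hv : ∫ e, g e ^ 2 ∂ν ≤ C * p)
    {W : ι → Ω → ℝ} (hW : ∀ i, Measurable (W i)) (hW0 : ∀ i, ∀ᵐ ω ∂P, 0 ≤ W i ω)
    (hW4 : ∀ i, Integrable (fun ω => (W i ω - μ) ^ 4) P)
    (hWZ : IndepFun (fun ω i => W i ω) (fun ω i => Z i ω) P) :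
    P {ω | β * k ≤ ∑ i, W i ω * g (Z i ω)}
      ≤ ∑ i, P {ω | β / 8 * k < W i ω * g (Z i ω)}
        + ENNReal.ofReal ((C / (ρ * (β / 8) * k)) ^ 4 *
            (8 * μ ^ 4 + 8 * ∑ i, ∫ ω, (W i ω - μ) ^ 4 ∂P)) := by
  have hWm : Measurable fun ω i => W i ω := measurable_pi_lambda _ hW
  have hZm : Measurable fun ω i => Z i ω := measurable_pi_lambda _ hZ
  have hS : MeasurableSet {q : (ι → ℝ) × (ι → E) | β * k ≤ ∑ i, q.1 i * g (q.2 i)} := by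
    apply measurableSet_le measurable_const
    fun_prop
  have hSi : ∀ i, MeasurableSet {q : (ι → ℝ) × (ι → E) | β / 8 * k < q.1 i * g (q.2 i)} := by
    intro i
    apply measurableSet_lt measurable_const
    fun_prop
  have h1 := measure_prodMk_mem_of_indepFun hWm hZm hWZ hS
  have h1i := fun i => measure_prodMk_mem_of_indepFun hWm hZm hWZ (hSi i)
  simp only [Set.mem_ofPred_eq] at h1 h1i
  rw [h1]
  simp_rw [h1i]
  set K : ℝ := (C / (ρ * (β / 8) * k)) ^ 4 with hK
  have hK0 : 0 ≤ K := by positivity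
  -- The weights are frozen at `ω` and the deterministic bound is applied with `A` the fourth root
  -- of `8 μ⁴ + 8 ∑ (W i - μ)⁴`, which dominates every weight and has an integrable fourth power.
  have hae : ∀ᵐ ω ∂P, P {ω' | β * k ≤ ∑ i, W i ω * g (Z i ω')}
      ≤ ∑ i, P {ω' | β / 8 * k < W i ω * g (Z i ω')}
        + ENNReal.ofReal (K * (8 * μ ^ 4 + 8 * ∑ i, (W i ω - μ) ^ 4)) := by
    filter_upwards [ae_all_iff.2 hW0] with ω hω
    set M : ℝ := 8 * μ ^ 4 + 8 * ∑ i, (W i ω - μ) ^ 4 with hM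
    have hM0 : 0 < M := by
      have : 0 ≤ ∑ i, (W i ω - μ) ^ 4 := Finset.sum_nonneg fun i _ => by positivity
      positivity
    set A : ℝ := Real.sqrt (Real.sqrt M) with hAdef
    have hA4 : A ^ 4 = M := by
      rw [show A ^ 4 = (A ^ 2) ^ 2 by ring, hAdef, Real.sq_sqrt (Real.sqrt_nonneg _),
        Real.sq_sqrt hM0.le]
    have hA0 : 0 < A := Real.sqrt_pos.2 (Real.sqrt_pos.2 hM0)
    have hwA : ∀ i, W i ω ≤ A := by
      intro i
      refine le_of_pow_le_pow_left₀ (n := 4) (by norm_num) hA0.le ?_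
      rw [hA4]
      have h2 : (W i ω - μ) ^ 4 ≤ ∑ i, (W i ω - μ) ^ 4 :=
        Finset.single_le_sum (f := fun i => (W i ω - μ) ^ 4) (fun i _ => by positivity)
          (Finset.mem_univ i)
      have h3 := add_pow_four_le (a := μ) (b := W i ω - μ)
      rw [add_sub_cancel] at h3
      linarith
    have := measure_weighted_sum_ge_le hZ hind hlaw hg hg1 hg2 hp hC hρ hA0 hk hβ hm hv hω hwA
    rwa [hA4] at this
  have hmeas : ∀ i, Measurable fun ω => P {ω' | β / 8 * k < W i ω * g (Z i ω')} := by
    intro i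
    have h2 := (measurable_measure_prodMk_left (ν := P.map fun ω i => Z i ω) (hSi i)).comp hWm
    convert h2 using 2 with ω
    simp only [Function.comp]
    rw [Measure.map_apply hZm (measurable_prodMk_left (hSi i))]
    rfl
  refine (lintegral_mono_ae hae).trans ?_
  rw [lintegral_add_left (Finset.measurable_fun_sum _ fun i _ => hmeas i),
    lintegral_finsetSum _ fun i _ => hmeas i]
  gcongr
  rw [← ofReal_integral_eq_lintegral_ofReal]
  · rw [integral_const_mul, integral_add (integrable_const _)
      ((integrable_finsetSum _ fun i _ => hW4 i).const_mul 8), integral_const,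
      integral_const_mul, integral_finsetSum _ fun i _ => hW4 i]
    simp
  · exact ((integrable_const _).add
      ((integrable_finsetSum _ fun i _ => hW4 i).const_mul 8)).const_mul K
  · refine ae_of_all _ fun ω => ?_
    have : 0 ≤ ∑ i, (W i ω - μ) ^ 4 := Finset.sum_nonneg fun i _ => by positivity
    simp only [Pi.zero_apply]
    positivity

end WeightedSums

/-! ### The leaf of a point -/

/-- The inequality on the left of `x` is weak because `x` may lie on a lower face of the cube,
outside the half-open root cell; the descent through the tree still keeps `x` in the closure. -/
theorem SplitTree.leafBox_bounds {d : ℕ} {x a b : Fin d → ℝ} (t : SplitTree d) {B : Box d}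
    (ht : t.Admissible B)
    (hB : ∀ j, a j ≤ B.lower j ∧ B.lower j ≤ x j ∧ x j ≤ B.upper j ∧ B.upper j ≤ b j) (j : Fin d) :
    a j ≤ (t.leafBox x B).lower j ∧ (t.leafBox x B).lower j ≤ x j ∧
      x j ≤ (t.leafBox x B).upper j ∧ (t.leafBox x B).upper j ≤ b j := by
  induction t generalizing B with
  | leaf => exact hB j
  | node i c l r ihl ihr =>
    obtain ⟨hc, hl, hr⟩ := ht
    rw [Box.side, Set.mem_Ioc] at hc
    have hi := hB i
    unfold SplitTree.leafBox
    split_ifs with h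
    · refine ihl hl fun j' => ?_
      rcases eq_or_ne j' i with rfl | hne
      · simp only [Box.left, Function.update_self]
        exact ⟨hi.1, hi.2.1, h, hc.2.trans hi.2.2.2⟩
      · simpa only [Box.left, Function.update_of_ne hne] using hB j'
    · push Not at h
      refine ihr hr fun j' => ?_
      rcases eq_or_ne j' i with rfl | hne
      · simp only [Box.right, Function.update_self]
        exact ⟨hi.1.trans hc.1.le, h.le, hi.2.2⟩
      · simpa only [Box.right, Function.update_of_ne hne] using hB j'

theorem Box.measurableSet_toSet {d : ℕ} (B : Box d) : MeasurableSet B.toSet := by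
  unfold Box.toSet
  rw [Set.ofPred_forall]
  exact MeasurableSet.iInter fun j => measurableSet_Ioc.preimage (measurable_pi_apply j)

theorem Box.measurable_indicator_toSet (d : ℕ) : Measurable
    fun q : ((Fin d → ℝ) × (Fin d → ℝ)) × (Fin d → ℝ) =>
      (Box.mk q.1.1 q.1.2).toSet.indicator (fun _ => (1 : ℝ)) q.2 := by
  have hS : MeasurableSet {q : ((Fin d → ℝ) × (Fin d → ℝ)) × (Fin d → ℝ) |
      ∀ j, q.1.1 j < q.2 j ∧ q.2 j ≤ q.1.2 j} := by
    rw [Set.ofPred_forall]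
    refine MeasurableSet.iInter fun j => ?_
    rw [Set.ofPred_and]
    exact (measurableSet_lt (by fun_prop) (by fun_prop)).inter
      (measurableSet_le (by fun_prop) (by fun_prop))
  exact (measurable_const (a := (1 : ℝ))).indicator hS

theorem Box.measurable_indicator_side {d : ℕ} (j : Fin d) : Measurable
    fun q : ((Fin d → ℝ) × (Fin d → ℝ)) × (Fin d → ℝ) =>
      ((Box.mk q.1.1 q.1.2).side j).indicator (fun _ => (1 : ℝ)) (q.2 j) := by
  have hS : MeasurableSet {q : ((Fin d → ℝ) × (Fin d → ℝ)) × (Fin d → ℝ) |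
      q.1.1 j < q.2 j ∧ q.2 j ≤ q.1.2 j} := by
    rw [Set.ofPred_and]
    exact (measurableSet_lt (by fun_prop) (by fun_prop)).inter
      (measurableSet_le (by fun_prop) (by fun_prop))
  exact (measurable_const (a := (1 : ℝ))).indicator hS

/-! ### Leaf statistics as measurable functions of the corners and the prediction data -/

namespace BootstrapTree

variable {Ω Θ : Type*} {d : ℕ}

/-- The weighted number of prediction observations in a given box. -/
noncomputable def boxCount (T : BootstrapTree Ω Θ d) (n : ℕ) (B : Box d)
    (h : ((n : ℕ) → Fin (T.nI n) → ℝ) × (ℕ → (Fin d → ℝ) × ℝ)) : ℝ :=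
  ∑ i : Fin (T.nI n), h.1 n i * B.toSet.indicator (fun _ => (1 : ℝ)) (h.2 i).1

/-- The weighted number of prediction observations in a strip given by a side of a box. -/
noncomputable def stripCount (T : BootstrapTree Ω Θ d) (j : Fin d) (n : ℕ) (B : Box d)
    (h : ((n : ℕ) → Fin (T.nI n) → ℝ) × (ℕ → (Fin d → ℝ) × ℝ)) : ℝ :=
  ∑ i : Fin (T.nI n), h.1 n i * (B.side j).indicator (fun _ => (1 : ℝ)) ((h.2 i).1 j)

/-- The weighted mean response in a given box. -/
noncomputable def boxMean (T : BootstrapTree Ω Θ d) (n : ℕ) (B : Box d)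
    (h : ((n : ℕ) → Fin (T.nI n) → ℝ) × (ℕ → (Fin d → ℝ) × ℝ)) : ℝ :=
  ∑ i : Fin (T.nI n), h.1 n i * B.toSet.indicator (fun _ => (1 : ℝ)) (h.2 i).1
    / T.boxCount n B h * (h.2 i).2

/-- The prediction sample together with its weights. -/
def predictionData (T : BootstrapTree Ω Θ d) (ω : Ω) :
    ((n : ℕ) → Fin (T.nI n) → ℝ) × (ℕ → (Fin d → ℝ) × ℝ) :=
  (T.weightsI ω, fun i => T.ZI i ω)

/-- The corners of the leaves of `x` at all stages. -/
noncomputable def leafCorners (T : BootstrapTree Ω Θ d) (x : Fin d → ℝ) (ω : Ω) :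
    ℕ → (Fin d → ℝ) × (Fin d → ℝ) :=
  fun n => ((T.leaf x n ω).lower, (T.leaf x n ω).upper)

theorem leafCount_eq (T : BootstrapTree Ω Θ d) (x : Fin d → ℝ) (n : ℕ) (ω : Ω) :
    T.leafCount x n ω = T.boxCount n (T.leaf x n ω) (T.predictionData ω) := by
  unfold leafCount
  rw [Finset.sum_range]
  rfl

theorem sideCount_eq (T : BootstrapTree Ω Θ d) (x : Fin d → ℝ) (j : Fin d) (n : ℕ) (ω : Ω) :
    T.sideCount x j n ω = T.stripCount j n (T.leaf x n ω) (T.predictionData ω) := by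
  unfold sideCount
  rw [Finset.sum_range]
  rfl

theorem predict_eq (T : BootstrapTree Ω Θ d) (x : Fin d → ℝ) (n : ℕ) (ω : Ω) :
    T.predict x n ω = T.boxMean n (T.leaf x n ω) (T.predictionData ω) := by
  unfold predict
  rw [leafCount_eq, Finset.sum_range]
  rfl

section Measurability

variable (T : BootstrapTree Ω Θ d) (n : ℕ)

theorem measurable_boxCount : Measurable
    fun q : (ℕ → (Fin d → ℝ) × (Fin d → ℝ)) ×
        (((n : ℕ) → Fin (T.nI n) → ℝ) × (ℕ → (Fin d → ℝ) × ℝ)) =>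
      T.boxCount n ⟨(q.1 n).1, (q.1 n).2⟩ q.2 := by
  unfold boxCount
  refine Finset.measurable_fun_sum _ fun i _ => Measurable.mul (by fun_prop) ?_
  exact (Box.measurable_indicator_toSet d).comp
    (show Measurable fun q : (ℕ → (Fin d → ℝ) × (Fin d → ℝ)) ×
        (((n : ℕ) → Fin (T.nI n) → ℝ) × (ℕ → (Fin d → ℝ) × ℝ)) =>
      (q.1 n, (q.2.2 i).1) by fun_prop)

theorem measurable_stripCount (j : Fin d) : Measurable
    fun q : (ℕ → (Fin d → ℝ) × (Fin d → ℝ)) ×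
        (((n : ℕ) → Fin (T.nI n) → ℝ) × (ℕ → (Fin d → ℝ) × ℝ)) =>
      T.stripCount j n ⟨(q.1 n).1, (q.1 n).2⟩ q.2 := by
  unfold stripCount
  refine Finset.measurable_fun_sum _ fun i _ => Measurable.mul (by fun_prop) ?_
  exact (Box.measurable_indicator_side j).comp
    (show Measurable fun q : (ℕ → (Fin d → ℝ) × (Fin d → ℝ)) ×
        (((n : ℕ) → Fin (T.nI n) → ℝ) × (ℕ → (Fin d → ℝ) × ℝ)) =>
      (q.1 n, (q.2.2 i).1) by fun_prop)

theorem measurable_boxMean : Measurable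
    fun q : (ℕ → (Fin d → ℝ) × (Fin d → ℝ)) ×
        (((n : ℕ) → Fin (T.nI n) → ℝ) × (ℕ → (Fin d → ℝ) × ℝ)) =>
      T.boxMean n ⟨(q.1 n).1, (q.1 n).2⟩ q.2 := by
  unfold boxMean
  refine Finset.measurable_fun_sum _ fun i _ => Measurable.mul (Measurable.div
    (Measurable.mul (by fun_prop) ?_) (measurable_boxCount T n)) (by fun_prop)
  exact (Box.measurable_indicator_toSet d).comp
    (show Measurable fun q : (ℕ → (Fin d → ℝ) × (Fin d → ℝ)) ×
        (((n : ℕ) → Fin (T.nI n) → ℝ) × (ℕ → (Fin d → ℝ) × ℝ)) =>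
      (q.1 n, (q.2.2 i).1) by fun_prop)

end Measurability

/-! ### Honesty: the leaf is independent of the prediction data -/

variable [MeasurableSpace Ω] [MeasurableSpace Θ] {T : BootstrapTree Ω Θ d} {P : Measure Ω}
  {f : (Fin d → ℝ) → ℝ} {κ : Kernel (Fin d → ℝ) ℝ} {x : Fin d → ℝ}

theorem WeightAssumption.measurable_weightsI (hw : T.WeightAssumption P) :
    Measurable T.weightsI :=
  measurable_pi_lambda _ fun n => measurable_pi_lambda _ fun i => hw.measurable_WI n i i.2

theorem WeightAssumption.measurable_weightsJ (hw : T.WeightAssumption P) :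
    Measurable T.weightsJ :=
  measurable_pi_lambda _ fun n => measurable_pi_lambda _ fun i => hw.measurable_WJ n i i.2

theorem Honest.measurable_sampleI (hh : T.Honest P f κ) : Measurable fun ω i => T.ZI i ω :=
  measurable_pi_lambda _ hh.measurable_ZI

theorem Honest.measurable_sampleJ (hh : T.Honest P f κ) : Measurable fun ω i => T.ZJ i ω :=
  measurable_pi_lambda _ hh.measurable_ZJ

theorem Honest.indepFun_samples (hh : T.Honest P f κ) :
    IndepFun (fun ω i => T.ZI i ω) (fun ω i => T.ZJ i ω) P := by
  have h1 := hh.indep_observations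
  rw [iIndepFun_iff_iIndep] at h1
  have h2 := indep_iSup_of_disjoint (S := Set.range Sum.inl) (T := Set.range Sum.inr)
    (fun i => ?_) h1 Set.isCompl_range_inl_range_inr.disjoint
  · rw [IndepFun_iff_Indep]
    rw [iSup_range, iSup_range] at h2
    simp only [MeasurableSpace.pi, MeasurableSpace.comap_iSup, MeasurableSpace.comap_comp]
    exact h2
  · rcases i with i | i
    · exact (hh.measurable_ZI i).comap_le
    · exact (hh.measurable_ZJ i).comap_le

theorem Honest.leafCorners_eq_comp (hh : T.Honest P f κ) (hx : x ∈ Set.Icc (0 : Fin d → ℝ) 1) :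
    ∃ F : (((n : ℕ) → Fin (T.nJ n) → ℝ) × Θ × (ℕ → (Fin d → ℝ) × ℝ)) →
        ℕ → (Fin d → ℝ) × (Fin d → ℝ),
      Measurable F ∧ T.leafCorners x = F ∘ fun ω => (T.weightsJ ω, T.θ ω, fun i => T.ZJ i ω) := by
  refine ⟨fun q n =>
    (((T.grow n q.2.1 (fun i => q.2.2 i) (q.1 n)).leafBox x (Box.unit d)).lower,
      ((T.grow n q.2.1 (fun i => q.2.2 i) (q.1 n)).leafBox x (Box.unit d)).upper), ?_, rfl⟩
  refine measurable_pi_lambda _ fun n => Measurable.prodMk ?_ ?_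
  · refine measurable_pi_lambda _ fun j => ?_
    exact (hh.measurable_lower n x hx j).comp
      (show Measurable fun q : ((n : ℕ) → Fin (T.nJ n) → ℝ) × Θ × (ℕ → (Fin d → ℝ) × ℝ) =>
        (q.2.1, (fun i : Fin (T.nJ n) => q.2.2 i), q.1 n) by fun_prop)
  · refine measurable_pi_lambda _ fun j => ?_
    exact (hh.measurable_upper n x hx j).comp
      (show Measurable fun q : ((n : ℕ) → Fin (T.nJ n) → ℝ) × Θ × (ℕ → (Fin d → ℝ) × ℝ) =>
        (q.2.1, (fun i : Fin (T.nJ n) => q.2.2 i), q.1 n) by fun_prop)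

/-- The corners depend only on `θ`, the splitting sample and its weights. The independence
assumptions are regrouped one block at a time until prediction data stand on one side and growing
data on the other. -/
theorem indepFun_leafCorners_predictionData [IsProbabilityMeasure P] (hh : T.Honest P f κ) (hw : T.WeightAssumption P)
    (hx : x ∈ Set.Icc (0 : Fin d → ℝ) 1) :
    Measurable (T.leafCorners x) ∧ Measurable T.predictionData ∧
      IndepFun (T.leafCorners x) T.predictionData P := by
  have mI := hh.measurable_sampleI
  have mJ := hh.measurable_sampleJ
  have mθ := hh.measurable_θ
  have mWI := hw.measurable_weightsI
  have mWJ := hw.measurable_weightsJ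
  obtain ⟨F, hF, hcorner⟩ := hh.leafCorners_eq_comp hx
  have h1 : IndepFun (fun ω => (T.θ ω, fun i => T.ZJ i ω)) (fun ω i => T.ZI i ω) P :=
    IndepFun.prodMk_left_of_prodMk_right mθ mJ mI
      (hh.indep_θ.comp measurable_id measurable_swap) hh.indepFun_samples.symm
  have h2 : IndepFun (fun ω => (T.weightsJ ω, T.θ ω, fun i => T.ZJ i ω))
      (fun ω i => T.ZI i ω) P :=
    IndepFun.prodMk_left_of_prodMk_right mWJ (mθ.prodMk mJ) mI
      (hw.indep_WJ.comp measurable_id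
        (show Measurable fun q : Θ × ((ℕ → (Fin d → ℝ) × ℝ) × (ℕ → (Fin d → ℝ) × ℝ)) =>
          ((q.1, q.2.2), q.2.1) by fun_prop)) h1
  have h3 : IndepFun (fun ω => (T.weightsI ω, fun i => T.ZI i ω))
      (fun ω => (T.weightsJ ω, T.θ ω, fun i => T.ZJ i ω)) P :=
    IndepFun.prodMk_left_of_prodMk_right mWI mI (mWJ.prodMk (mθ.prodMk mJ))
      (hw.indep_WI.comp measurable_id
        (show Measurable fun q : ((n : ℕ) → Fin (T.nJ n) → ℝ) × Θ ×
            ((ℕ → (Fin d → ℝ) × ℝ) × (ℕ → (Fin d → ℝ) × ℝ)) =>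
          (q.2.2.1, (q.1, q.2.1, q.2.2.2)) by fun_prop)) h2.symm
  refine ⟨?_, mWI.prodMk mI, ?_⟩
  · rw [hcorner]
    exact hF.comp (mWJ.prodMk (mθ.prodMk mJ))
  · rw [hcorner]
    exact h3.symm.comp hF measurable_id

/-- Reduction to leaves that do not depend on chance. -/
theorem ae_tendsto_predict_of_forall_boxes [IsProbabilityMeasure P] (hh : T.Honest P f κ) (hw : T.WeightAssumption P)
    (hx : x ∈ Set.Icc (0 : Fin d → ℝ) 1) {k : ℕ → ℝ} {c y : ℝ}
    (hmin : ∀ᵐ ω ∂P, ∀ᶠ n in atTop, k n ≤ T.leafCount x n ω)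
    (hbalance : ∀ j : Fin d, ∀ᵐ ω ∂P,
      Tendsto (fun n => T.sideCount x j n ω / (T.nI n * T.meanWeight P n)) atTop (𝓝 0))
    (hmgf : T.MGFAssumption P f κ x c)
    (hbox : ∀ B : ℕ → Box d,
      (∀ n j, 0 ≤ (B n).lower j ∧ (B n).lower j ≤ x j ∧ x j ≤ (B n).upper j
        ∧ (B n).upper j ≤ 1) →
      (∀ᵐ ω ∂P, ∀ᶠ n in atTop, k n ≤ T.boxCount n (B n) (T.predictionData ω)) →
      (∀ j, ∀ᵐ ω ∂P, Tendsto (fun n => T.stripCount j n (B n) (T.predictionData ω)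
        / (T.nI n * T.meanWeight P n)) atTop (𝓝 0)) →
      (∀ q : ℚ, (q : ℝ) ∈ Set.Ioo (-c) c →
        (∀ᶠ n in atTop, IntegrableOn
          (fun z => (T.condMGF P κ n q z - 1) / T.meanWeight P n * f z) (B n).toSet) ∧
        Tendsto (fun n => 1 / (B n).vol * (∫ z in (B n).toSet,
            (T.condMGF P κ n q z - 1) / T.meanWeight P n * f z)
          - (T.condMGF P κ n q x - 1) / T.meanWeight P n * f x) atTop (𝓝 0)) →
      ∀ᵐ ω ∂P, Tendsto (fun n => T.boxMean n (B n) (T.predictionData ω)) atTop (𝓝 y)) :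
    ∀ᵐ ω ∂P, Tendsto (fun n => T.predict x n ω) atTop (𝓝 y) := by
  obtain ⟨mL, mH, hind⟩ := indepFun_leafCorners_predictionData hh hw hx
  simp_rw [leafCount_eq] at hmin
  simp_rw [sideCount_eq] at hbalance
  simp_rw [predict_eq]
  have hSmin : MeasurableSet {q : (ℕ → (Fin d → ℝ) × (Fin d → ℝ)) ×
      (((n : ℕ) → Fin (T.nI n) → ℝ) × (ℕ → (Fin d → ℝ) × ℝ)) |
      ∀ᶠ n in atTop, k n ≤ T.boxCount n ⟨(q.1 n).1, (q.1 n).2⟩ q.2} := by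
    simp only [eventually_atTop, Set.ofPred_exists, Set.ofPred_forall]
    exact MeasurableSet.iUnion fun m => MeasurableSet.iInter fun n => MeasurableSet.iInter fun _ =>
      measurableSet_le measurable_const (T.measurable_boxCount n)
  have hSbal : ∀ j, MeasurableSet {q : (ℕ → (Fin d → ℝ) × (Fin d → ℝ)) ×
      (((n : ℕ) → Fin (T.nI n) → ℝ) × (ℕ → (Fin d → ℝ) × ℝ)) |
      Tendsto (fun n => T.stripCount j n ⟨(q.1 n).1, (q.1 n).2⟩ q.2
        / (T.nI n * T.meanWeight P n)) atTop (𝓝 0)} := fun j =>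
    measurableSet_tendsto _ fun n => (T.measurable_stripCount n j).div_const _
  have hSmean : MeasurableSet {q : (ℕ → (Fin d → ℝ) × (Fin d → ℝ)) ×
      (((n : ℕ) → Fin (T.nI n) → ℝ) × (ℕ → (Fin d → ℝ) × ℝ)) |
      Tendsto (fun n => T.boxMean n ⟨(q.1 n).1, (q.1 n).2⟩ q.2) atTop (𝓝 y)} :=
    measurableSet_tendsto _ fun n => T.measurable_boxMean n
  refine (ae_prodMk_mem_iff_of_indepFun mL mH hind hSmean).2 ?_
  have h1 := (ae_prodMk_mem_iff_of_indepFun mL mH hind hSmin).1 hmin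
  have h2 := fun j => (ae_prodMk_mem_iff_of_indepFun mL mH hind (hSbal j)).1 (hbalance j)
  -- The exceptional null set depends on the parameter, so only countably many parameters can be
  -- used at once. Chance enters this condition only through the leaf, so no Fubini argument is
  -- needed.
  have h3 := ae_all_iff.2 fun q : ℚ =>
    ae_all_iff.2 fun hq : (q : ℝ) ∈ Set.Ioo (-c) c => hmgf.average q hq
  filter_upwards [h1, ae_all_iff.2 h2, h3] with ω h1 h2 h3
  refine hbox (fun n => T.leaf x n ω) (fun n j => ?_) h1 h2 h3
  exact SplitTree.leafBox_bounds _ (hh.admissible n _ _ _) (a := fun _ => 0) (b := fun _ => 1)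
    (fun j => ⟨le_rfl, hx.1 j, hx.2 j, le_rfl⟩) j

end BootstrapTree

/-! ### The law of the covariates -/

/-- The law of the covariates, with density `f` on the unit cube. -/
noncomputable def covariateLaw {d : ℕ} (f : (Fin d → ℝ) → ℝ) : Measure (Fin d → ℝ) :=
  (volume.restrict (Set.Icc 0 1)).withDensity (fun z => ENNReal.ofReal (f z))

section CovariateLaw

variable {d : ℕ} {f : (Fin d → ℝ) → ℝ} {κ : Kernel (Fin d → ℝ) ℝ}

theorem jointLaw_eq : jointLaw f κ = covariateLaw f ⊗ₘ κ := rfl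

instance : SFinite (covariateLaw f) := by unfold covariateLaw; infer_instance

theorem isProbabilityMeasure_covariateLaw [IsMarkovKernel κ]
    [h : IsProbabilityMeasure (jointLaw f κ)] : IsProbabilityMeasure (covariateLaw f) := by
  rw [jointLaw_eq] at h
  rw [← Measure.fst_compProd (covariateLaw f) κ]
  infer_instance

theorem ae_covariateLaw_mem_Icc : ∀ᵐ z ∂(covariateLaw f), z ∈ Set.Icc (0 : Fin d → ℝ) 1 :=
  (withDensity_absolutelyContinuous _ _).ae_le (ae_restrict_mem measurableSet_Icc)

theorem covariateLaw_restrict {S : Set (Fin d → ℝ)} (hS : MeasurableSet S)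
    (hS1 : S ⊆ Set.Icc 0 1) : (covariateLaw f).restrict S
      = (volume.restrict S).withDensity (fun z => ENNReal.ofReal (f z)) := by
  rw [covariateLaw, restrict_withDensity hS, Measure.restrict_restrict hS,
    Set.inter_eq_left.2 hS1]

namespace CovariateAssumption

variable (hf : CovariateAssumption f κ)
include hf

theorem density_pos {z : Fin d → ℝ} (hz : z ∈ Set.Icc (0 : Fin d → ℝ) 1) : 0 < f z := by
  obtain ⟨ε, C, hε, h⟩ := hf.bounds
  exact hε.trans_le (h z hz).1

theorem aemeasurable_density {S : Set (Fin d → ℝ)} (hS : MeasurableSet S)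
    (hS1 : S ⊆ Set.Icc 0 1) : AEMeasurable f (volume.restrict S) :=
  (hf.continuous_density.mono hS1).aemeasurable hS

theorem setIntegral_covariateLaw {S : Set (Fin d → ℝ)} (hS : MeasurableSet S)
    (hS1 : S ⊆ Set.Icc 0 1) (h : (Fin d → ℝ) → ℝ) :
    ∫ z in S, h z ∂(covariateLaw f) = ∫ z in S, h z * f z := by
  rw [covariateLaw_restrict hS hS1]
  have h1 := integral_withDensity_eq_integral_smul₀
    (f := fun z => (f z).toNNReal) (hf.aemeasurable_density hS hS1).real_toNNReal h
  refine h1.trans (setIntegral_congr_fun hS fun z hz => ?_)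
  rw [NNReal.smul_def, Real.coe_toNNReal _ (hf.density_pos (hS1 hz)).le, smul_eq_mul, mul_comm]

theorem integrableOn_covariateLaw_iff {S : Set (Fin d → ℝ)} (hS : MeasurableSet S)
    (hS1 : S ⊆ Set.Icc 0 1) (h : (Fin d → ℝ) → ℝ) :
    IntegrableOn h S (covariateLaw f) ↔ IntegrableOn (fun z => h z * f z) S := by
  unfold IntegrableOn
  rw [covariateLaw_restrict hS hS1]
  have h1 := integrable_withDensity_iff_integrable_smul₀
    (f := fun z => (f z).toNNReal) (hf.aemeasurable_density hS hS1).real_toNNReal (g := h)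
  refine h1.trans (integrable_congr ?_)
  filter_upwards [ae_restrict_mem hS] with z hz
  rw [NNReal.smul_def, Real.coe_toNNReal _ (hf.density_pos (hS1 hz)).le, smul_eq_mul, mul_comm]

theorem integrableOn_density {S : Set (Fin d → ℝ)} (hS1 : S ⊆ Set.Icc 0 1) : IntegrableOn f S :=
  (hf.continuous_density.integrableOn_compact isCompact_Icc).mono_set hS1

theorem real_covariateLaw {S : Set (Fin d → ℝ)} (hS : MeasurableSet S)
    (hS1 : S ⊆ Set.Icc 0 1) : (covariateLaw f).real S = ∫ z in S, f z := by
  have h1 := hf.setIntegral_covariateLaw hS hS1 (fun _ => 1)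
  simpa using h1

theorem exists_sq_bound : ∃ K : ℝ, 0 ≤ K ∧ ∀ z ∈ Set.Icc (0 : Fin d → ℝ) 1,
    ∫ y, y ^ 2 ∂(κ z) ≤ K := by
  obtain ⟨K, hK⟩ := hf.bounded_sq
  exact ⟨max K 0, le_max_right _ _, fun z hz => (hK z hz).trans (le_max_left _ _)⟩

variable [IsMarkovKernel κ]

theorem integrable_response {z : Fin d → ℝ} (hz : z ∈ Set.Icc (0 : Fin d → ℝ) 1) :
    Integrable (fun y : ℝ => y) (κ z) := by
  refine ((integrable_const (1 : ℝ)).add (hf.integrable_sq z hz)).mono'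
    measurable_id.aestronglyMeasurable (ae_of_all _ fun y => ?_)
  rw [Real.norm_eq_abs]
  simp only [Pi.add_apply]
  nlinarith [sq_abs y, sq_nonneg (|y| - 1), abs_nonneg y]

theorem abs_condMean_le {K : ℝ} {z : Fin d → ℝ} (hz : z ∈ Set.Icc (0 : Fin d → ℝ) 1)
    (hK : ∫ y, y ^ 2 ∂(κ z) ≤ K) : |∫ y, y ∂(κ z)| ≤ 1 + K := by
  refine (abs_integral_le_integral_abs).trans ?_
  have h1 : ∫ y, |y| ∂(κ z) ≤ ∫ y, (1 + y ^ 2) ∂(κ z) := by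
    refine integral_mono (hf.integrable_response hz).abs
      ((integrable_const (1 : ℝ)).add (hf.integrable_sq z hz)) fun y => ?_
    simp only
    nlinarith [sq_abs y, sq_nonneg (|y| - 1), abs_nonneg y]
  rw [integral_add (integrable_const _) (hf.integrable_sq z hz)] at h1
  simp at h1
  linarith

theorem integrable_condMean [IsFiniteMeasure (covariateLaw f)] :
    Integrable (fun z => ∫ y, y ∂(κ z)) (covariateLaw f) := by
  obtain ⟨K, hK0, hK⟩ := hf.exists_sq_bound
  refine Integrable.of_bound ?_ (1 + K) ?_
  · exact (measurable_id.stronglyMeasurable.integral_kernel).aestronglyMeasurable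
  · filter_upwards [ae_covariateLaw_mem_Icc] with z hz
    exact hf.abs_condMean_le hz (hK z hz)

theorem integrable_sq_jointLaw [IsFiniteMeasure (covariateLaw f)] :
    Integrable (fun q : (Fin d → ℝ) × ℝ => q.2 ^ 2) (jointLaw f κ) := by
  obtain ⟨K, hK0, hK⟩ := hf.exists_sq_bound
  have hm : Measurable fun q : (Fin d → ℝ) × ℝ => q.2 ^ 2 := by fun_prop
  rw [jointLaw_eq, Measure.integrable_compProd_iff hm.aestronglyMeasurable]
  constructor
  · filter_upwards [ae_covariateLaw_mem_Icc] with z hz using hf.integrable_sq z hz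
  · refine Integrable.of_bound ?_ K ?_
    · refine StronglyMeasurable.aestronglyMeasurable ?_
      exact StronglyMeasurable.integral_kernel (f := fun y : ℝ => ‖y ^ 2‖)
        (by fun_prop : Measurable fun y : ℝ => ‖y ^ 2‖).stronglyMeasurable
    · filter_upwards [ae_covariateLaw_mem_Icc] with z hz
      simp only [norm_pow, Real.norm_eq_abs, sq_abs]
      rw [abs_of_nonneg (integral_nonneg fun y => sq_nonneg y)]
      exact hK z hz

/-! ### Moments of the localized response `1_S(X) (s Y - b)`, with a sign `s = ±1` for the two tails
-/

variable {S : Set (Fin d → ℝ)} {s b : ℝ}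

omit hf [IsMarkovKernel κ] in
theorem measurable_localized (hS : MeasurableSet S) : Measurable
    fun q : (Fin d → ℝ) × ℝ => S.indicator (fun _ => (1 : ℝ)) q.1 * (s * q.2 - b) :=
  (((measurable_const (a := (1 : ℝ))).indicator hS).comp measurable_fst).mul (by fun_prop)

omit hf [IsMarkovKernel κ] in
theorem sq_localized_le (hs : s * s = 1) (q : (Fin d → ℝ) × ℝ) :
    (S.indicator (fun _ => (1 : ℝ)) q.1 * (s * q.2 - b)) ^ 2
      ≤ S.indicator (fun _ => (1 : ℝ)) q.1 * (2 * q.2 ^ 2 + 2 * b ^ 2) := by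
  by_cases h : q.1 ∈ S
  · simp only [Set.indicator_of_mem h]
    nlinarith [sq_nonneg (s * q.2 + b), congrArg (· * q.2 ^ 2) hs]
  · simp [Set.indicator_of_notMem h]

theorem integrable_sq_localized [IsFiniteMeasure (covariateLaw f)] (hS : MeasurableSet S)
    (hs : s * s = 1) : Integrable (fun q : (Fin d → ℝ) × ℝ =>
      (S.indicator (fun _ => (1 : ℝ)) q.1 * (s * q.2 - b)) ^ 2) (jointLaw f κ) := by
  have : IsFiniteMeasure (jointLaw f κ) := by rw [jointLaw_eq]; infer_instance
  refine ((hf.integrable_sq_jointLaw.const_mul 2).add (integrable_const (2 * b ^ 2))).mono'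
    ((measurable_localized hS).pow_const 2).aestronglyMeasurable (ae_of_all _ fun q => ?_)
  rw [Real.norm_eq_abs, abs_of_nonneg (sq_nonneg _)]
  refine (sq_localized_le hs q).trans ?_
  have h0 : 0 ≤ 2 * q.2 ^ 2 + 2 * b ^ 2 := by positivity
  refine mul_le_of_le_one_left h0 ?_
  exact Set.indicator_apply_le' (fun _ => le_rfl) fun _ => zero_le_one

theorem integrable_localized [IsFiniteMeasure (covariateLaw f)] (hS : MeasurableSet S)
    (hs : s * s = 1) : Integrable (fun q : (Fin d → ℝ) × ℝ =>
      S.indicator (fun _ => (1 : ℝ)) q.1 * (s * q.2 - b)) (jointLaw f κ) := by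
  have : IsFiniteMeasure (jointLaw f κ) := by rw [jointLaw_eq]; infer_instance
  refine ((hf.integrable_sq_localized hS hs (b := b)).add (integrable_const 1)).mono'
    (measurable_localized hS).aestronglyMeasurable (ae_of_all _ fun q => ?_)
  rw [Real.norm_eq_abs]
  simp only [Pi.add_apply]
  set u := S.indicator (fun _ => (1 : ℝ)) q.1 * (s * q.2 - b)
  nlinarith [sq_abs u, sq_nonneg (|u| - 1), abs_nonneg u]

theorem integral_localized [IsFiniteMeasure (covariateLaw f)] (hS : MeasurableSet S)
    (hs : s * s = 1) :
    ∫ q, S.indicator (fun _ => (1 : ℝ)) q.1 * (s * q.2 - b) ∂(jointLaw f κ)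
      = s * ∫ z in S, (∫ y, y ∂(κ z)) ∂(covariateLaw f) - b * (covariateLaw f).real S := by
  rw [jointLaw_eq, Measure.integral_compProd (μ := covariateLaw f)
    (hf.integrable_localized hS hs)]
  have h1 : ∀ᵐ z ∂(covariateLaw f), ∫ y, S.indicator (fun _ => (1 : ℝ)) z * (s * y - b) ∂(κ z)
      = S.indicator (fun z => s * (∫ y, y ∂(κ z)) - b) z := by
    filter_upwards [ae_covariateLaw_mem_Icc] with z hz
    rw [integral_const_mul, integral_sub ((hf.integrable_response hz).const_mul s)
      (integrable_const b), integral_const_mul]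
    by_cases h : z ∈ S <;> simp [h]
  rw [integral_congr_ae h1, integral_indicator hS,
    integral_sub (hf.integrable_condMean.integrableOn.const_mul s) (integrable_const b),
    integral_const_mul]
  simp [mul_comm]

/-- The point is proportionality to the mass of `S`, the scaling that the large deviation bound
requires of the variance relative to the drift. -/
theorem integral_sq_localized_le [IsFiniteMeasure (covariateLaw f)] (hS : MeasurableSet S)
    (hs : s * s = 1) {K : ℝ} (hK : ∀ z ∈ Set.Icc (0 : Fin d → ℝ) 1, ∫ y, y ^ 2 ∂(κ z) ≤ K) :
    ∫ q, (S.indicator (fun _ => (1 : ℝ)) q.1 * (s * q.2 - b)) ^ 2 ∂(jointLaw f κ)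
      ≤ (2 * K + 2 * b ^ 2) * (covariateLaw f).real S := by
  rw [jointLaw_eq, Measure.integral_compProd (μ := covariateLaw f)
    (hf.integrable_sq_localized hS hs)]
  have h1 : ∀ᵐ z ∂(covariateLaw f),
      ∫ y, (S.indicator (fun _ => (1 : ℝ)) z * (s * y - b)) ^ 2 ∂(κ z)
        ≤ S.indicator (fun _ => 2 * K + 2 * b ^ 2) z := by
    filter_upwards [ae_covariateLaw_mem_Icc] with z hz
    by_cases h : z ∈ S
    · have h2 : ∫ y, (S.indicator (fun _ => (1 : ℝ)) z * (s * y - b)) ^ 2 ∂(κ z)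
          ≤ ∫ y, (2 * y ^ 2 + 2 * b ^ 2) ∂(κ z) := by
        refine integral_mono_of_nonneg (ae_of_all _ fun y => sq_nonneg _)
          (((hf.integrable_sq z hz).const_mul 2).add (integrable_const _))
          (ae_of_all _ fun y => ?_)
        refine (sq_localized_le (S := S) hs (z, y)).trans (le_of_eq ?_)
        simp [h]
      rw [integral_add ((hf.integrable_sq z hz).const_mul 2) (integrable_const _),
        integral_const_mul] at h2
      simp only [Set.indicator_of_mem h] at h2 ⊢
      simp only [integral_const, probReal_univ, one_smul, one_mul] at h2 ⊢
      linarith [hK z hz]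
    · simp [h]
  refine (integral_mono_of_nonneg (ae_of_all _ fun z => integral_nonneg fun y => sq_nonneg _)
    ((integrable_const _).indicator hS) h1).trans (le_of_eq ?_)
  rw [integral_indicator hS]
  simp [mul_comm]

end CovariateAssumption

/-! ### Boxes inside the unit cube -/

namespace Box

variable {B : Box d}

theorem toSet_eq_pi (B : Box d) :
    B.toSet = Set.univ.pi fun j => Set.Ioc (B.lower j) (B.upper j) := by
  ext z; simp [Box.toSet]

theorem toSet_subset_Icc (hB : ∀ j, 0 ≤ B.lower j ∧ B.upper j ≤ 1) :
    B.toSet ⊆ Set.Icc 0 1 := fun _ hz =>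
  ⟨fun j => (hB j).1.trans (hz j).1.le, fun j => (hz j).2.trans (hB j).2⟩

theorem real_volume_toSet (hB : ∀ j, B.lower j ≤ B.upper j) : volume.real B.toSet = B.vol := by
  rw [toSet_eq_pi, Measure.real, Real.volume_pi_Ioc_toReal hB]
  rfl

theorem vol_nonneg (hB : ∀ j, B.lower j ≤ B.upper j) : 0 ≤ B.vol :=
  Finset.prod_nonneg fun j _ => sub_nonneg.2 (hB j)

theorem volume_toSet_ne_top (B : Box d) : volume B.toSet ≠ ⊤ := by
  rw [toSet_eq_pi, Real.volume_pi_Ioc]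
  exact ENNReal.prod_ne_top fun j _ => ENNReal.ofReal_ne_top

/-- Degenerate boxes are covered too: if the volume vanishes, both sides are zero. -/
theorem setIntegral_eq_vol_mul_average (hB : ∀ j, B.lower j ≤ B.upper j)
    (h : (Fin d → ℝ) → ℝ) :
    ∫ z in B.toSet, h z = B.vol * (1 / B.vol * ∫ z in B.toSet, h z) := by
  rcases eq_or_ne B.vol 0 with h0 | h0
  · have h1 : volume B.toSet = 0 := by
      rw [← real_volume_toSet hB, Measure.real, ENNReal.toReal_eq_zero_iff] at h0
      exact h0.resolve_right B.volume_toSet_ne_top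
    rw [Measure.restrict_eq_zero.2 h1]
    simp
  · field_simp

end Box

/-- The strip contains the box that is full in all other directions, whose volume is `b - a`. -/
theorem CovariateAssumption.side_le_real_strip (hf : CovariateAssumption f κ) {ε : ℝ}
    (hfε : ∀ z ∈ Set.Icc (0 : Fin d → ℝ) 1, ε ≤ f z) (j : Fin d) {a b : ℝ}
    (ha : 0 ≤ a) (hab : a ≤ b) (hb : b ≤ 1) [IsFiniteMeasure (covariateLaw f)] :
    ε * (b - a) ≤ (covariateLaw f).real {z | z j ∈ Set.Ioc a b} := by
  set B : Box d := ⟨Function.update 0 j a, Function.update 1 j b⟩ with hBdef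
  have hB : ∀ i, 0 ≤ B.lower i ∧ B.lower i ≤ B.upper i ∧ B.upper i ≤ 1 := by
    intro i
    rcases eq_or_ne i j with rfl | hne
    · simp [hBdef, ha, hab, hb]
    · simp [hBdef, hne]
  have hvol : B.vol = b - a := by
    unfold Box.vol
    rw [Finset.prod_eq_single j]
    · simp [hBdef]
    · intro i _ hne
      simp [hBdef, hne]
    · simp
  have hsub : B.toSet ⊆ {z | z j ∈ Set.Ioc a b} := by
    intro z hz
    simpa [hBdef] using hz j
  have hBI : B.toSet ⊆ Set.Icc 0 1 := Box.toSet_subset_Icc fun i => ⟨(hB i).1, (hB i).2.2⟩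
  calc ε * (b - a) = ∫ _z in B.toSet, ε := by
        rw [setIntegral_const, Box.real_volume_toSet fun i => (hB i).2.1, hvol, smul_eq_mul,
          mul_comm]
    _ ≤ ∫ z in B.toSet, f z :=
        setIntegral_mono_on (integrableOn_const B.volume_toSet_ne_top)
          (hf.integrableOn_density hBI) B.measurableSet_toSet
          fun z hz => hfε z (hBI hz)
    _ = (covariateLaw f).real B.toSet :=
        (hf.real_covariateLaw B.measurableSet_toSet hBI).symm
    _ ≤ _ := measureReal_mono hsub

end CovariateLaw

/-! ### Convergence of means -/

/-- Nonnegative random variables with bounded second moments that tend to zero almost surely tend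
to zero in mean. -/
theorem tendsto_integral_zero_of_ae_of_sq_bounded {Ω : Type*} [MeasurableSpace Ω] {P : Measure Ω}
    [IsProbabilityMeasure P] {R : ℕ → Ω → ℝ} (hR : ∀ n, Measurable (R n))
    (hR0 : ∀ᶠ n in atTop, ∀ᵐ ω ∂P, 0 ≤ R n ω) {C : ℝ}
    (hint : ∀ᶠ n in atTop, Integrable (R n) P)
    (hsq : ∀ᶠ n in atTop, Integrable (fun ω => R n ω ^ 2) P)
    (hC : ∀ᶠ n in atTop, ∫ ω, R n ω ^ 2 ∂P ≤ C)
    (hlim : ∀ᵐ ω ∂P, Tendsto (fun n => R n ω) atTop (𝓝 0)) :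
    Tendsto (fun n => ∫ ω, R n ω ∂P) atTop (𝓝 0) := by
  have hC0 : 0 ≤ C := by
    obtain ⟨n, hn⟩ := hC.exists
    exact (integral_nonneg fun ω => sq_nonneg _).trans hn
  rw [Metric.tendsto_atTop']
  intro ε hε
  -- The truncation at `M` costs at most `C / M < ε / 2` in mean, since `R ≤ R ^ 2 / M` beyond it.
  set M : ℝ := 2 * (C + 1) / ε with hM
  have hM0 : 0 < M := by positivity
  have htr : Tendsto (fun n => ∫ ω, min |R n ω| M ∂P) atTop (𝓝 (∫ _ω, (0 : ℝ) ∂P)) := by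
    refine tendsto_integral_of_dominated_convergence (fun _ => M)
      (fun n => ((hR n).norm.min measurable_const).aestronglyMeasurable) (integrable_const M)
      (fun n => ae_of_all _ fun ω => ?_) ?_
    · rw [Real.norm_eq_abs, abs_of_nonneg (le_min (abs_nonneg _) hM0.le)]
      exact min_le_right _ _
    · filter_upwards [hlim] with ω hω
      have h1 := hω.abs.min (tendsto_const_nhds (x := M))
      simpa [hM0.le] using h1
  simp only [integral_zero] at htr
  have h2 := htr.eventually (gt_mem_nhds (half_pos hε))
  obtain ⟨n₀, hn₀⟩ := eventually_atTop.1 (hR0.and (hint.and (hsq.and (hC.and h2))))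
  refine ⟨n₀, fun n hn => ?_⟩
  obtain ⟨h0, hi, hs, hc, ht⟩ := hn₀ n hn.le
  rw [Real.dist_eq, sub_zero, abs_of_nonneg (integral_nonneg_of_ae h0)]
  have h4 : Integrable (fun ω => min |R n ω| M) P := by
    refine Integrable.of_bound
      (f := fun ω => min |R n ω| M) ((hR n).norm.min measurable_const).aestronglyMeasurable M (ae_of_all _ fun ω => ?_)
    rw [Real.norm_eq_abs, abs_of_nonneg (le_min (abs_nonneg _) hM0.le)]
    exact min_le_right _ _
  have h3 : ∫ ω, R n ω ∂P ≤ ∫ ω, (min |R n ω| M + R n ω ^ 2 / M) ∂P := by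
    refine integral_mono hi (h4.add (hs.div_const M)) fun ω => ?_
    · simp only
      rcases le_total |R n ω| M with h | h
      · rw [min_eq_left h]
        have : 0 ≤ R n ω ^ 2 / M := by positivity
        linarith [le_abs_self (R n ω)]
      · rw [min_eq_right h]
        have : |R n ω| ≤ R n ω ^ 2 / M := by
          rw [le_div_iff₀ hM0, ← sq_abs, sq]
          gcongr
        linarith [le_abs_self (R n ω)]
  rw [integral_add h4 (hs.div_const M), integral_div] at h3
  have h5 : (∫ ω, R n ω ^ 2 ∂P) / M < ε / 2 := by
    rw [div_lt_iff₀ hM0, hM]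
    have : ε / 2 * (2 * (C + 1) / ε) = C + 1 := by field_simp
    linarith
  linarith

namespace BootstrapTree

variable {Ω Θ : Type*} {d : ℕ} [MeasurableSpace Ω] [MeasurableSpace Θ]
  {T : BootstrapTree Ω Θ d} {P : Measure Ω}
  {f : (Fin d → ℝ) → ℝ} {κ : Kernel (Fin d → ℝ) ℝ} {x : Fin d → ℝ} {c : ℝ}

/-! ### Moments of the weights -/

namespace WeightAssumption

variable (hw : T.WeightAssumption P)
include hw

theorem identDistrib_WI {n i : ℕ} (hi : i < T.nI n) :
    IdentDistrib (T.WI n i) (T.WI n 0) P P := by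
  have h0 : 0 < T.nI n := (Nat.zero_le i).trans_lt hi
  refine ⟨(hw.measurable_WI n i hi).aemeasurable, (hw.measurable_WI n 0 h0).aemeasurable, ?_⟩
  have h1 := hw.exchangeable_WI n (Equiv.swap ⟨0, h0⟩ ⟨i, hi⟩)
  have h2 := congrArg (Measure.map fun v => v ⟨0, h0⟩) h1
  rw [Measure.map_map (measurable_pi_apply _) (measurable_pi_lambda _ fun j =>
      hw.measurable_WI n _ (Fin.is_lt _)), Measure.map_map (measurable_pi_apply _)
      (measurable_pi_lambda _ fun j => hw.measurable_WI n _ (Fin.is_lt _))] at h2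
  simpa [Function.comp_def] using h2

theorem integral_mul_WI {n i j : ℕ} (hi : i < T.nI n) (hj : j < T.nI n) (hij : i ≠ j) :
    ∫ ω, T.WI n i ω * T.WI n j ω ∂P = ∫ ω, T.WI n 0 ω * T.WI n 1 ω ∂P := by
  have h1n : 1 < T.nI n := by omega
  have h0n : 0 < T.nI n := by omega
  obtain ⟨σ, hσ0, hσ1⟩ : ∃ σ : Equiv.Perm (Fin (T.nI n)),
      σ ⟨0, h0n⟩ = ⟨i, hi⟩ ∧ σ ⟨1, h1n⟩ = ⟨j, hj⟩ := by
    set τ := Equiv.swap (⟨0, h0n⟩ : Fin (T.nI n)) ⟨i, hi⟩ with hτ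
    have hne : τ ⟨j, hj⟩ ≠ ⟨0, h0n⟩ := by
      intro h
      have h' := congrArg τ h
      rw [hτ, Equiv.swap_apply_left, Equiv.swap_apply_self] at h'
      exact hij (by simpa using h'.symm)
    -- The inner transposition fixes `0` because `τ j ≠ 0`, and sends `1` to `τ j`, which the
    -- involution `τ` returns to `j`.
    refine ⟨τ * Equiv.swap ⟨1, h1n⟩ (τ ⟨j, hj⟩), ?_, ?_⟩
    · rw [Equiv.Perm.mul_apply, Equiv.swap_apply_of_ne_of_ne (by simp) hne.symm, hτ,
        Equiv.swap_apply_left]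
    · rw [Equiv.Perm.mul_apply, Equiv.swap_apply_left, hτ, Equiv.swap_apply_self]
  have hm : ∀ σ : Equiv.Perm (Fin (T.nI n)), Measurable fun ω i => T.WI n (σ i) ω := fun σ =>
    measurable_pi_lambda _ fun j => hw.measurable_WI n _ (Fin.is_lt _)
  have hm' : Measurable fun ω (i : Fin (T.nI n)) => T.WI n i ω :=
    measurable_pi_lambda _ fun j => hw.measurable_WI n _ (Fin.is_lt _)
  have hφ : StronglyMeasurable fun v : Fin (T.nI n) → ℝ => v ⟨0, h0n⟩ * v ⟨1, h1n⟩ :=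
    (by fun_prop : Measurable fun v : Fin (T.nI n) → ℝ =>
      v ⟨0, h0n⟩ * v ⟨1, h1n⟩).stronglyMeasurable
  have h1 := hw.exchangeable_WI n σ
  have h2 := congrArg (fun ν => ∫ v, v ⟨0, h0n⟩ * v ⟨1, h1n⟩ ∂ν) h1
  simp only at h2
  rw [integral_map (hm σ).aemeasurable hφ.aestronglyMeasurable,
    integral_map hm'.aemeasurable hφ.aestronglyMeasurable] at h2
  simpa [hσ0, hσ1] using h2

end WeightAssumption

section Moments

variable (hw : T.WeightAssumption P) (hc : 0 < c) (hmgf : T.MGFAssumption P f κ x c)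
include hw hc hmgf

/-- Finite exponential moments near zero give all moments. -/
theorem integrable_pow_WI {n i : ℕ} (hi : i < T.nI n) (p : ℕ) :
    Integrable (fun ω => T.WI n i ω ^ p) P := by
  have h0 : Integrable (fun ω => T.WI n 0 ω ^ p) P := by
    refine integrable_pow_of_mem_interior_integrableExpSet ?_ p
    refine mem_interior_iff_mem_nhds.2 (mem_of_superset (Ioo_mem_nhds (neg_lt_zero.2 hc) hc) ?_)
    exact fun t ht => hmgf.exists_weight n t ht
  exact ((hw.identDistrib_WI hi).comp (measurable_id.pow_const p)).integrable_iff.2 h0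

theorem integrable_WI {n i : ℕ} (hi : i < T.nI n) : Integrable (T.WI n i) P := by
  simpa using integrable_pow_WI hw hc hmgf hi 1

theorem integrable_sub_pow_four [IsProbabilityMeasure P] {n i : ℕ} (hi : i < T.nI n) (a : ℝ) :
    Integrable (fun ω => (T.WI n i ω - a) ^ 4) P := by
  have h := integrable_pow_WI hw hc hmgf hi
  have h1 : (fun ω => (T.WI n i ω - a) ^ 4) = fun ω => T.WI n i ω ^ 4
      + (-(4 * a)) * T.WI n i ω ^ 3 + (6 * a ^ 2) * T.WI n i ω ^ 2
      + (-(4 * a ^ 3)) * T.WI n i ω ^ 1 + a ^ 4 := by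
    ext ω; ring
  rw [h1]
  exact ((((h 4).add ((h 3).const_mul _)).add ((h 2).const_mul _)).add
    ((h 1).const_mul _)).add (integrable_const _)

theorem integrable_mul_WI {n i j : ℕ} (hi : i < T.nI n) (hj : j < T.nI n) :
    Integrable (fun ω => T.WI n i ω * T.WI n j ω) P := by
  have h : ∀ {l}, l < T.nI n → MemLp (T.WI n l) 2 P := fun hl =>
    (memLp_two_iff_integrable_sq (hw.measurable_WI n _ hl).aestronglyMeasurable).2
      (integrable_pow_WI hw hc hmgf hl 2)
  exact (h hi).integrable_mul (h hj)

theorem integrable_sq_sum_WI (n : ℕ) :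
    Integrable (fun ω => (∑ i : Fin (T.nI n), T.WI n i ω) ^ 2) P := by
  simp_rw [sq, Finset.sum_mul_sum]
  exact integrable_finsetSum _ fun i _ => integrable_finsetSum _ fun j _ =>
    integrable_mul_WI hw hc hmgf i.2 j.2

/-- The square splits into diagonal and off-diagonal terms, all equal within each kind by
exchangeability; the nonnegative mixed moment is also added on the diagonal. -/
theorem integral_sq_sum_WI_le {n : ℕ} (hn : 1 < T.nI n) :
    ∫ ω, (∑ i : Fin (T.nI n), T.WI n i ω) ^ 2 ∂P
      ≤ T.nI n * ∫ ω, T.WI n 0 ω ^ 2 ∂P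
        + (T.nI n : ℝ) ^ 2 * ∫ ω, T.WI n 0 ω * T.WI n 1 ω ∂P := by
  simp_rw [sq (∑ i : Fin (T.nI n), _), Finset.sum_mul_sum]
  rw [integral_finsetSum _ fun i _ => integrable_finsetSum _ fun j _ =>
    integrable_mul_WI hw hc hmgf i.2 j.2]
  have h0 : 0 ≤ ∫ ω, T.WI n 0 ω * T.WI n 1 ω ∂P := by
    refine integral_nonneg_of_ae ?_
    filter_upwards [hw.nonneg_WI n 0 (by omega), hw.nonneg_WI n 1 hn] with ω h0 h1
    exact mul_nonneg h0 h1
  have h1 : 0 ≤ ∫ ω, T.WI n 0 ω ^ 2 ∂P := integral_nonneg fun ω => sq_nonneg _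
  have h2 : ∀ i j : Fin (T.nI n), ∫ ω, T.WI n i ω * T.WI n j ω ∂P
      ≤ (if i = j then ∫ ω, T.WI n 0 ω ^ 2 ∂P else 0) + ∫ ω, T.WI n 0 ω * T.WI n 1 ω ∂P := by
    intro i j
    split_ifs with h
    · subst h
      have h3 := ((hw.identDistrib_WI i.2).comp (measurable_id.pow_const 2)).integral_eq
      simp only [Function.comp_def, id] at h3
      simp_rw [← sq]
      linarith
    · rw [hw.integral_mul_WI i.2 j.2 (fun h' => h (Fin.ext h')), zero_add]
  calc _ ≤ ∑ i : Fin (T.nI n), ∑ j : Fin (T.nI n),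
        ((if i = j then ∫ ω, T.WI n 0 ω ^ 2 ∂P else 0) + ∫ ω, T.WI n 0 ω * T.WI n 1 ω ∂P) := by
        refine Finset.sum_le_sum fun i _ => ?_
        rw [integral_finsetSum _ fun j _ => integrable_mul_WI hw hc hmgf i.2 j.2]
        exact Finset.sum_le_sum fun j _ => h2 i j
    _ = _ := by
        simp only [Finset.sum_add_distrib, Finset.sum_ite_eq, Finset.mem_univ, if_true,
          Finset.sum_const, Finset.card_univ, Fintype.card_fin, nsmul_eq_mul]
        ring

omit hc hmgf in
theorem meanWeight_nonneg (hn : ∀ n, 0 < T.nI n) (n : ℕ) : 0 ≤ T.meanWeight P n :=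
  integral_nonneg_of_ae (hw.nonneg_WI n 0 (hn n))

end Moments

/-! ### Counts in a fixed box -/

section Counts

variable (hh : T.Honest P f κ) (hw : T.WeightAssumption P)
include hh hw

theorem measurable_boxCount_predictionData (n : ℕ) (B : Box d) :
    Measurable fun ω => T.boxCount n B (T.predictionData ω) :=
  (T.measurable_boxCount n).comp (show Measurable fun ω =>
    ((fun _ => (B.lower, B.upper) : ℕ → (Fin d → ℝ) × (Fin d → ℝ)), T.predictionData ω) from
    measurable_const.prodMk (hw.measurable_weightsI.prodMk hh.measurable_sampleI))

theorem measurable_stripCount_predictionData (j : Fin d) (n : ℕ) (B : Box d) :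
    Measurable fun ω => T.stripCount j n B (T.predictionData ω) :=
  (T.measurable_stripCount n j).comp (show Measurable fun ω =>
    ((fun _ => (B.lower, B.upper) : ℕ → (Fin d → ℝ) × (Fin d → ℝ)), T.predictionData ω) from
    measurable_const.prodMk (hw.measurable_weightsI.prodMk hh.measurable_sampleI))

omit hh in
theorem ae_nonneg_weightsI : ∀ᵐ ω ∂P, ∀ n, ∀ i : Fin (T.nI n), 0 ≤ T.WI n i ω :=
  ae_all_iff.2 fun n => ae_all_iff.2 fun i => hw.nonneg_WI n i i.2

omit hh in
theorem indepFun_weightsI_sampleI : IndepFun T.weightsI (fun ω i => T.ZI i ω) P :=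
  hw.indep_WI.comp measurable_id
    (show Measurable fun q : ((n : ℕ) → Fin (T.nJ n) → ℝ) × Θ ×
        ((ℕ → (Fin d → ℝ) × ℝ) × (ℕ → (Fin d → ℝ) × ℝ)) => q.2.2.1 by fun_prop)

omit hh in
theorem indepFun_WI_ZI [IsProbabilityMeasure P] {n i : ℕ} (hi : i < T.nI n) (j : ℕ) :
    IndepFun (T.WI n i) (T.ZI j) P :=
  (indepFun_weightsI_sampleI hw).comp
    (show Measurable fun q : (n : ℕ) → Fin (T.nI n) → ℝ => q n ⟨i, hi⟩ by fun_prop)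
    (measurable_pi_apply j)

omit hw in
theorem isProbabilityMeasure_jointLaw [IsProbabilityMeasure P] :
    IsProbabilityMeasure (jointLaw f κ) := by
  rw [← hh.law_ZI 0]
  exact Measure.isProbabilityMeasure_map (hh.measurable_ZI 0).aemeasurable

omit hw in
theorem map_fst_ZI [IsMarkovKernel κ] (i : ℕ) :
    P.map (fun ω => (T.ZI i ω).1) = covariateLaw f := by
  have h1 : P.map (fun ω => (T.ZI i ω).1) = (P.map (T.ZI i)).map Prod.fst := by
    rw [Measure.map_map measurable_fst (hh.measurable_ZI i)]; rfl
  rw [h1, hh.law_ZI i, jointLaw_eq]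
  exact Measure.fst_compProd _ _

variable (hc : 0 < c) (hmgf : T.MGFAssumption P f κ x c) [IsProbabilityMeasure P]
include hc hmgf

omit hc hmgf in
theorem integral_weighted_indicator [IsMarkovKernel κ] {n i : ℕ} (hi : i < T.nI n)
    {S : Set (Fin d → ℝ)} (hS : MeasurableSet S) :
    ∫ ω, T.WI n i ω * S.indicator (fun _ => (1 : ℝ)) (T.ZI i ω).1 ∂P
      = T.meanWeight P n * (covariateLaw f).real S := by
  have hφ : Measurable fun q : (Fin d → ℝ) × ℝ => S.indicator (fun _ => (1 : ℝ)) q.1 :=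
    ((measurable_const (a := (1 : ℝ))).indicator hS).comp measurable_fst
  have h1 := ((indepFun_WI_ZI hw hi i).comp measurable_id hφ).integral_mul_eq_mul_integral
    (hw.measurable_WI n i hi).aestronglyMeasurable
    (hφ.comp (hh.measurable_ZI i)).aestronglyMeasurable
  simp only [Pi.mul_apply, Function.comp_def, id] at h1
  rw [h1, (hw.identDistrib_WI hi).integral_eq]
  congr 1
  have h2 : ∫ ω, S.indicator (fun _ => (1 : ℝ)) (T.ZI i ω).1 ∂P
      = ∫ z, S.indicator (fun _ => (1 : ℝ)) z ∂(P.map fun ω => (T.ZI i ω).1) := by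
    rw [integral_map ((hh.measurable_ZI i).fst).aemeasurable]
    exact ((measurable_const (a := (1 : ℝ))).indicator hS).aestronglyMeasurable
  rw [h2, map_fst_ZI hh, integral_indicator hS]
  simp

omit [IsProbabilityMeasure P] in
theorem integrable_weighted_indicator {n i : ℕ} (hi : i < T.nI n)
    {S : Set (Fin d → ℝ)} (hS : MeasurableSet S) :
    Integrable (fun ω => T.WI n i ω * S.indicator (fun _ => (1 : ℝ)) (T.ZI i ω).1) P := by
  have hφ : Measurable fun q : (Fin d → ℝ) × ℝ => S.indicator (fun _ => (1 : ℝ)) q.1 :=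
    ((measurable_const (a := (1 : ℝ))).indicator hS).comp measurable_fst
  refine (integrable_WI hw hc hmgf hi).mul_bdd (c := 1)
    (hφ.comp (hh.measurable_ZI i)).aestronglyMeasurable (ae_of_all _ fun ω => ?_)
  by_cases h : (T.ZI i ω).1 ∈ S <;> simp [h]

theorem integral_boxCount_le [IsMarkovKernel κ] (n : ℕ) (B : Box d) :
    Integrable (fun ω => T.boxCount n B (T.predictionData ω)) P ∧
    ∫ ω, T.boxCount n B (T.predictionData ω) ∂P ≤ T.nI n * T.meanWeight P n := by
  have hi := fun i : Fin (T.nI n) =>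
    integrable_weighted_indicator hh hw hc hmgf i.2 B.measurableSet_toSet
  refine ⟨integrable_finsetSum _ fun i _ => hi i, ?_⟩
  have h1 : ∫ ω, T.boxCount n B (T.predictionData ω) ∂P
      = ∑ i : Fin (T.nI n), T.meanWeight P n * (covariateLaw f).real B.toSet := by
    refine (integral_finsetSum _ fun i _ => hi i).trans (Finset.sum_congr rfl fun i _ => ?_)
    exact integral_weighted_indicator hh hw i.2 B.measurableSet_toSet
  have := isProbabilityMeasure_jointLaw hh
  have : IsProbabilityMeasure (covariateLaw f) :=
    isProbabilityMeasure_covariateLaw (f := f) (κ := κ)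
  rw [h1]
  simp only [Finset.sum_const, Finset.card_univ, Fintype.card_fin, nsmul_eq_mul]
  have h0 := meanWeight_nonneg hw hh.nI_pos n
  have h2 : (covariateLaw f).real B.toSet ≤ 1 := measureReal_le_one
  gcongr
  exact mul_le_of_le_one_right h0 h2

theorem integral_stripCount [IsMarkovKernel κ] (j : Fin d) (n : ℕ) (B : Box d) :
    Integrable (fun ω => T.stripCount j n B (T.predictionData ω)) P ∧
    ∫ ω, T.stripCount j n B (T.predictionData ω) ∂P = T.nI n * T.meanWeight P n
      * (covariateLaw f).real {z | z j ∈ Set.Ioc (B.lower j) (B.upper j)} := by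
  have hS : MeasurableSet {z : Fin d → ℝ | z j ∈ Set.Ioc (B.lower j) (B.upper j)} :=
    measurableSet_Ioc.preimage (measurable_pi_apply j)
  have hi := fun i : Fin (T.nI n) => integrable_weighted_indicator hh hw hc hmgf i.2 hS
  refine ⟨integrable_finsetSum _ fun i _ => hi i, ?_⟩
  refine (integral_finsetSum _ fun i _ => hi i).trans ?_
  rw [Finset.sum_congr rfl fun i _ => integral_weighted_indicator hh hw i.2 hS]
  simp only [Finset.sum_const, Finset.card_univ, Fintype.card_fin, nsmul_eq_mul]
  ring

end Counts

/-! ### Sample sizes and minimal leaf sizes -/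

section Sizes

variable {k : ℕ → ℝ}

theorem tendsto_leafSize (hk : ∀ δ : ℝ, 0 < δ → Summable (fun n => Real.exp (-δ * k n))) :
    Tendsto k atTop atTop := by
  have h1 := (hk 1 one_pos).tendsto_atTop_zero
  rw [Real.tendsto_exp_comp_nhds_zero] at h1
  simpa using h1

theorem Honest.tendsto_nI (hh : T.Honest P f κ) : Tendsto (fun n => (T.nI n : ℝ)) atTop atTop := by
  have h1 := hh.nI_theta.tendsto_norm_atTop_iff.2
    (by simpa [Function.comp_def] using tendsto_natCast_atTop_atTop (R := ℝ))
  simpa [Function.comp_def] using h1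

theorem Honest.summable_inv_nI_sq (hh : T.Honest P f κ) :
    Summable fun n => ((T.nI n : ℝ) ^ 2)⁻¹ := by
  refine summable_of_isBigO_nat (Real.summable_nat_pow_inv.2 (by norm_num : 1 < 2)) ?_
  refine IsBigO.inv_rev (hh.nI_theta.2.pow 2) ?_
  filter_upwards [eventually_gt_atTop 0] with n hn h
  have h2 : (n : ℝ) ≠ 0 := by exact_mod_cast hn.ne'
  exact absurd h (pow_ne_zero 2 h2)

/-- The terms of the exponential series are eventually below one, so the exponential exceeds `nI ^
(4 * d) ≥ 3 > e`; here `d > 0` is needed. -/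
theorem eventually_mean_lt_sq_leafSize (hd : 0 < d) (hh : T.Honest P f κ)
    (hw : T.WeightAssumption P) (hsize : T.SummableLeafSize P k) :
    ∀ᶠ n in atTop, 8 * T.nI n * T.meanWeight P n ≤ k n ^ 2 := by
  filter_upwards [hsize.exponential.tendsto_atTop_zero.eventually (gt_mem_nhds one_pos),
    hh.tendsto_nI.eventually_ge_atTop 3] with n h1 h3
  have h0 := meanWeight_nonneg hw hh.nI_pos n
  rw [div_lt_one (Real.exp_pos _)] at h1
  rcases h0.eq_or_lt with h0 | h0
  · rw [← h0, mul_zero]; positivity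
  have h4 : (3 : ℝ) ≤ (T.nI n : ℝ) ^ (4 * d) :=
    h3.trans (le_self_pow₀ (by linarith) (by omega))
  have h5 : Real.exp 1 < Real.exp (k n ^ 2 / (8 * T.nI n * T.meanWeight P n)) :=
    (Real.exp_one_lt_d9.trans (by norm_num)).trans_le (h4.trans h1.le)
  rw [Real.exp_lt_exp, one_lt_div (by positivity)] at h5
  exact h5.le

/-- By dominated convergence `E[min (N / k) 1] → 1`, while `E[N] ≤ nI μ`; any constant below one
could replace `1 / 2`. Together with `k → ∞` this makes the total mean weight diverge. -/
theorem eventually_leafSize_le_mean [IsProbabilityMeasure P] [IsMarkovKernel κ]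
    (hh : T.Honest P f κ)
    (hw : T.WeightAssumption P) (hc : 0 < c) (hmgf : T.MGFAssumption P f κ x c)
    (hk : Tendsto k atTop atTop) {B : ℕ → Box d}
    (hmin : ∀ᵐ ω ∂P, ∀ᶠ n in atTop, k n ≤ T.boxCount n (B n) (T.predictionData ω)) :
    ∀ᶠ n in atTop, k n / 2 ≤ T.nI n * T.meanWeight P n := by
  have hmeas := fun n => (measurable_boxCount_predictionData hh hw n (B n)).div_const (k n)
  have htr : Tendsto (fun n => ∫ ω, min |T.boxCount n (B n) (T.predictionData ω) / k n| 1 ∂P)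
      atTop (𝓝 (∫ _ω, (1 : ℝ) ∂P)) := by
    refine tendsto_integral_of_dominated_convergence (fun _ => 1)
      (fun n => ((hmeas n).norm.min measurable_const).aestronglyMeasurable) (integrable_const 1)
      (fun n => ae_of_all _ fun ω => ?_) ?_
    · rw [Real.norm_eq_abs, abs_of_nonneg (le_min (abs_nonneg _) zero_le_one)]
      exact min_le_right _ _
    · filter_upwards [hmin] with ω hω
      refine tendsto_const_nhds.congr' ?_
      filter_upwards [hω, hk.eventually_gt_atTop 0] with n h1 h2
      rw [min_eq_right]
      exact ((one_le_div h2).2 h1).trans (le_abs_self _)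
  have h1 := htr.eventually (lt_mem_nhds (show (1 / 2 : ℝ) < ∫ _ω, (1 : ℝ) ∂P by
    rw [integral_const, probReal_univ]; norm_num))
  filter_upwards [h1, hk.eventually_gt_atTop 0] with n h1 h2
  obtain ⟨hi, hle⟩ := integral_boxCount_le hh hw hc hmgf n (B n)
  have h3 : ∫ ω, min |T.boxCount n (B n) (T.predictionData ω) / k n| 1 ∂P
      ≤ ∫ ω, T.boxCount n (B n) (T.predictionData ω) / k n ∂P := by
    refine integral_mono_of_nonneg (ae_of_all _ fun ω => le_min (abs_nonneg _) zero_le_one)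
      (hi.div_const _) ?_
    filter_upwards [ae_nonneg_weightsI hw] with ω hω
    refine (min_le_left _ _).trans (le_of_eq (abs_of_nonneg (div_nonneg ?_ h2.le)))
    exact Finset.sum_nonneg fun i _ => mul_nonneg (hω n i)
      (Set.indicator_nonneg (fun _ _ => zero_le_one) _)
  rw [integral_div] at h3
  have h4 := h1.trans_le (h3.trans (div_le_div_of_nonneg_right hle h2.le))
  rw [lt_div_iff₀ h2] at h4
  linarith

end Sizes

end BootstrapTree

/-! ### Exponential remainders controlled by the hyperbolic cosine -/

/-- With `p = exp (a / 4)` and `q = exp (-a)` one has `2 cosh a - 2 = p⁴ (1 - q)²`, and `a ≤ (1 +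
a)(1 - q) ≤ 4 p (1 - q)`. -/
theorem sq_mul_exp_half_le_cosh {a : ℝ} (ha : 0 ≤ a) :
    a ^ 2 * Real.exp (a / 2) ≤ 16 * (2 * Real.cosh a - 2) := by
  set p := Real.exp (a / 4) with hp
  set q := Real.exp (-a) with hq
  have h2 : Real.exp (a / 2) = p ^ 2 := by rw [hp, ← Real.exp_nat_mul]; congr 1; push_cast; ring
  have h4 : Real.exp a = p ^ 4 := by rw [hp, ← Real.exp_nat_mul]; congr 1; push_cast; ring
  have hpq : p ^ 4 * q = 1 := by rw [← h4, hq, ← Real.exp_add]; simp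
  have hp1 : 1 + a ≤ 4 * p := by linarith [Real.add_one_le_exp (a / 4)]
  have hp0 : 0 < p := Real.exp_pos _
  have hq0 : 0 < q := Real.exp_pos _
  have hq1 : (1 + a) * q ≤ 1 := by
    refine le_trans (mul_le_mul_of_nonneg_right ?_ hq0.le) hpq.le
    linarith [Real.add_one_le_exp a]
  have h5 : a ≤ (1 + a) * (1 - q) := by linarith
  have h6 : 0 ≤ 1 - q := by
    have : q ≤ 1 := Real.exp_le_one_iff.2 (by linarith)
    linarith
  have h7 : a ≤ 4 * p * (1 - q) := h5.trans (by gcongr)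
  have h8 : a ^ 2 ≤ (4 * p * (1 - q)) ^ 2 := by gcongr
  rw [h2, Real.cosh_eq, h4]
  calc a ^ 2 * p ^ 2 ≤ (4 * p * (1 - q)) ^ 2 * p ^ 2 := by gcongr
    _ = 16 * (p ^ 4 - 2 * (p ^ 4 * q) + p ^ 4 * q * q) := by ring
    _ = 16 * (2 * ((p ^ 4 + q) / 2) - 2) := by rw [hpq]; ring

/-- The remainder is quadratic in `r`, and `2 cosh v - 2 = (exp v - 1) + (exp (-v) - 1)` integrates
to centred transforms at two fixed parameters, which are `O(μ)` at `x`. -/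
theorem exp_mul_le_one_add_mul_add_cosh {r v : ℝ} (hr : |r| ≤ 1 / 2) :
    Real.exp (r * v) ≤ 1 + r * v + 16 * r ^ 2 * (2 * Real.cosh v - 2) := by
  have h1 : r * v ≤ |v| / 2 := by
    refine (le_abs_self _).trans ?_
    rw [abs_mul]
    linarith [mul_le_mul_of_nonneg_right hr (abs_nonneg v)]
  have h2 := exp_le_one_add_self_add_sq_mul_exp h1 (by positivity)
  have h3 := sq_mul_exp_half_le_cosh (abs_nonneg v)
  rw [Real.cosh_abs, sq_abs] at h3
  have h4 := mul_le_mul_of_nonneg_left h3 (sq_nonneg r)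
  nlinarith

namespace BootstrapTree

variable {Ω Θ : Type*} {d : ℕ} [MeasurableSpace Ω] [MeasurableSpace Θ]
  {T : BootstrapTree Ω Θ d} {P : Measure Ω} [IsProbabilityMeasure P]
  {f : (Fin d → ℝ) → ℝ} {κ : Kernel (Fin d → ℝ) ℝ} [IsMarkovKernel κ] {x : Fin d → ℝ} {c : ℝ}

/-! ### The boxes shrink to a point -/

section Shrinking

variable (hh : T.Honest P f κ) (hw : T.WeightAssumption P) (hc : 0 < c)
  (hmgf : T.MGFAssumption P f κ x c) (hcov : CovariateAssumption f κ) {B : ℕ → Box d}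
  (hB : ∀ n j, 0 ≤ (B n).lower j ∧ (B n).lower j ≤ x j ∧ x j ≤ (B n).upper j
    ∧ (B n).upper j ≤ 1)
  (hsum : Tendsto (fun n => T.nI n * T.meanWeight P n) atTop atTop)
  (hbal : ∀ j, ∀ᵐ ω ∂P, Tendsto (fun n => T.stripCount j n (B n) (T.predictionData ω)
    / (T.nI n * T.meanWeight P n)) atTop (𝓝 0))
include hh hw hc hmgf hcov hB hsum hbal

/-- The normalized strip count has mean equal to the mass of the strip, at least `ε` times the side.
Almost sure convergence to zero passes to means because the second moments stay bounded: the first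
two weight moments bound them by a quantity tending to `1`, hence eventually below `2`. -/
theorem tendsto_side_zero (j : Fin d) :
    Tendsto (fun n => (B n).upper j - (B n).lower j) atTop (𝓝 0) := by
  have := isProbabilityMeasure_jointLaw hh
  have : IsProbabilityMeasure (covariateLaw f) :=
    isProbabilityMeasure_covariateLaw (f := f) (κ := κ)
  set a : ℕ → ℝ := fun n => T.nI n * T.meanWeight P n with ha
  have hbound : ∀ n, ∀ᵐ ω ∂P, 0 ≤ T.stripCount j n (B n) (T.predictionData ω) ∧
      T.stripCount j n (B n) (T.predictionData ω) ≤ ∑ i : Fin (T.nI n), T.WI n i ω := by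
    intro n
    filter_upwards [ae_nonneg_weightsI hw] with ω hω
    constructor
    · exact Finset.sum_nonneg fun i _ => mul_nonneg (hω n i)
        (Set.indicator_nonneg (fun _ _ => zero_le_one) _)
    · refine Finset.sum_le_sum fun i _ => mul_le_of_le_one_right (hω n i) ?_
      exact Set.indicator_apply_le' (fun _ => le_rfl) fun _ => zero_le_one
  have hmeas := fun n => measurable_stripCount_predictionData hh hw j n (B n)
  have hint : ∀ n, Integrable (fun ω => T.stripCount j n (B n) (T.predictionData ω) ^ 2) P := by
    intro n
    refine (integrable_sq_sum_WI hw hc hmgf n).mono'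
      ((hmeas n).pow_const 2).aestronglyMeasurable ?_
    filter_upwards [hbound n] with ω hω
    rw [Real.norm_eq_abs, abs_of_nonneg (sq_nonneg _)]
    have := hω.1
    gcongr
    exact hω.2
  have hpos := hsum.eventually_gt_atTop 0
  have hlim1 : Tendsto (fun n => (∫ ω, (T.WI n 0 ω) ^ 2 ∂P) / T.meanWeight P n / a n
      + (∫ ω, T.WI n 0 ω * T.WI n 1 ω ∂P) / (T.meanWeight P n) ^ 2) atTop (𝓝 (0 + 1)) := by
    obtain ⟨L, hL⟩ := hw.second_moment
    exact (hL.div_atTop hsum).add hw.mixed_moment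
  have hlim := tendsto_integral_zero_of_ae_of_sq_bounded (P := P)
    (R := fun n ω => T.stripCount j n (B n) (T.predictionData ω) / a n) (C := 2)
    (fun n => (hmeas n).div_const _) ?_ ?_ ?_ ?_ (hbal j)
  · obtain ⟨ε, C, hε, hfb⟩ := hcov.bounds
    have h1 : Tendsto (fun n =>
        (covariateLaw f).real {z | z j ∈ Set.Ioc ((B n).lower j) ((B n).upper j)})
        atTop (𝓝 0) := by
      refine hlim.congr' ?_
      filter_upwards [hpos] with n hn
      rw [integral_div, (integral_stripCount hh hw hc hmgf j n (B n)).2]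
      exact mul_div_cancel_left₀ _ hn.ne'
    have h2 : Tendsto (fun n => ε⁻¹ *
        (covariateLaw f).real {z | z j ∈ Set.Ioc ((B n).lower j) ((B n).upper j)})
        atTop (𝓝 0) := by simpa using h1.const_mul ε⁻¹
    refine squeeze_zero (fun n => ?_) (fun n => ?_) h2
    · linarith [hB n j]
    · have h3 := hcov.side_le_real_strip (fun z hz => (hfb z hz).1) j (hB n j).1
        ((hB n j).2.1.trans (hB n j).2.2.1) (hB n j).2.2.2
      rw [le_inv_mul_iff₀ hε]
      exact h3
  · filter_upwards [hpos] with n hn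
    filter_upwards [hbound n] with ω hω using div_nonneg hω.1 hn.le
  · exact Eventually.of_forall fun n =>
      (integral_stripCount hh hw hc hmgf j n (B n)).1.div_const _
  · refine Eventually.of_forall fun n => ?_
    simp_rw [div_pow]
    exact (hint n).div_const _
  · filter_upwards [hpos, hlim1.eventually (gt_mem_nhds (show (0 : ℝ) + 1 < 2 by norm_num)),
      hh.tendsto_nI.eventually_gt_atTop 1] with n hn h1 hn1
    have hn1' : 1 < T.nI n := by exact_mod_cast hn1
    simp_rw [div_pow]
    rw [integral_div]
    have h2 : ∫ ω, T.stripCount j n (B n) (T.predictionData ω) ^ 2 ∂P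
        ≤ ∫ ω, (∑ i : Fin (T.nI n), T.WI n i ω) ^ 2 ∂P := by
      refine integral_mono_ae (hint n) (integrable_sq_sum_WI hw hc hmgf n) ?_
      filter_upwards [hbound n] with ω hω
      have := hω.1
      gcongr
      exact hω.2
    have h3 := h2.trans (integral_sq_sum_WI_le hw hc hmgf hn1')
    have h4 : (∫ ω, T.stripCount j n (B n) (T.predictionData ω) ^ 2 ∂P) / a n ^ 2
        ≤ (T.nI n * ∫ ω, T.WI n 0 ω ^ 2 ∂P
          + (T.nI n : ℝ) ^ 2 * ∫ ω, T.WI n 0 ω * T.WI n 1 ω ∂P) / a n ^ 2 := by gcongr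
    refine h4.trans (le_trans (le_of_eq ?_) h1.le)
    have hN : (T.nI n : ℝ) ≠ 0 := by positivity
    have hμ : T.meanWeight P n ≠ 0 := by
      intro h0
      exact absurd hn (by simp [ha, h0])
    simp only [ha]
    field_simp

theorem eventually_dist_lt {δ : ℝ} (hδ : 0 < δ) :
    ∀ᶠ n in atTop, ∀ z ∈ (B n).toSet, dist z x < δ := by
  have h1 := fun j => (tendsto_side_zero hh hw hc hmgf hcov hB hsum hbal j).eventually
    (gt_mem_nhds hδ)
  filter_upwards [eventually_all.2 h1] with n hn z hz
  rw [dist_pi_lt_iff hδ]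
  intro j
  have h2 := hz j
  rw [Set.mem_Ioc] at h2
  rw [Real.dist_eq, abs_lt]
  constructor <;> linarith [hn j, hB n j]

theorem eventually_abs_density_sub_le (hx : x ∈ Set.Icc (0 : Fin d → ℝ) 1) {η : ℝ} (hη : 0 < η) :
    ∀ᶠ n in atTop, ∀ z ∈ (B n).toSet, |f z - f x| ≤ η := by
  obtain ⟨δ, hδ, h1⟩ := Metric.continuousWithinAt_iff.1 (hcov.continuous_density x hx) η hη
  filter_upwards [eventually_dist_lt hh hw hc hmgf hcov hB hsum hbal hδ] with n hn z hz
  have hzI := Box.toSet_subset_Icc (fun j => ⟨(hB n j).1, (hB n j).2.2.2⟩) hz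
  exact (h1 hzI (hn z hz)).le

end Shrinking

/-! ### Inequalities for conditional moment generating functions -/

section CondMGF

variable (hh : T.Honest P f κ) (hw : T.WeightAssumption P) (hc : 0 < c)
  (hmgf : T.MGFAssumption P f κ x c) (hcov : CovariateAssumption f κ)
include hh hw hc hmgf hcov

theorem integral_WI_mul_response {z : Fin d → ℝ} (hz : z ∈ Set.Icc (0 : Fin d → ℝ) 1) (n : ℕ) :
    Integrable (fun q : Ω × ℝ => T.WI n 0 q.1 * q.2) (P.prod (κ z)) ∧
    ∫ q : Ω × ℝ, T.WI n 0 q.1 * q.2 ∂(P.prod (κ z))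
      = T.meanWeight P n * ∫ y, y ∂(κ z) :=
  ⟨(integrable_WI hw hc hmgf (hh.nI_pos n)).mul_prod (hcov.integrable_response hz),
    integral_prod_mul (T.WI n 0) (fun y : ℝ => y)⟩

theorem mul_condMean_le_condMGF {z : Fin d → ℝ} (hz : z ∈ Set.Icc (0 : Fin d → ℝ) 1) (n : ℕ)
    {t : ℝ} (ht : t ∈ Set.Ioo (-c) c) :
    t * (T.meanWeight P n * ∫ y, y ∂(κ z)) ≤ T.condMGF P κ n t z - 1 := by
  obtain ⟨h1, h2⟩ := integral_WI_mul_response hh hw hc hmgf hcov hz n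
  have h3 : ∫ q : Ω × ℝ, (1 + t * (T.WI n 0 q.1 * q.2)) ∂(P.prod (κ z))
      ≤ T.condMGF P κ n t z := by
    refine integral_mono ((integrable_const 1).add (h1.const_mul t))
      (hmgf.exists_response n t ht z hz) fun q => ?_
    simp only
    have := Real.add_one_le_exp (t * T.WI n 0 q.1 * q.2)
    linarith
  rw [integral_add (integrable_const 1) (h1.const_mul t), integral_const_mul, h2] at h3
  simp only [integral_const, probReal_univ, one_smul] at h3
  linarith

omit [MeasurableSpace Θ] hh hw hc hcov in
theorem integral_cosh_eq {z : Fin d → ℝ} (hz : z ∈ Set.Icc (0 : Fin d → ℝ) 1) (n : ℕ)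
    {t : ℝ} (ht : t ∈ Set.Ioo (-c) c) :
    Integrable (fun q : Ω × ℝ => 2 * Real.cosh (t * T.WI n 0 q.1 * q.2) - 2) (P.prod (κ z)) ∧
    ∫ q : Ω × ℝ, (2 * Real.cosh (t * T.WI n 0 q.1 * q.2) - 2) ∂(P.prod (κ z))
      = T.condMGF P κ n t z - 1 + (T.condMGF P κ n (-t) z - 1) := by
  have ht' : -t ∈ Set.Ioo (-c) c := ⟨by linarith [ht.2], by linarith [ht.1]⟩
  have h1 := hmgf.exists_response n t ht z hz
  have h2 := hmgf.exists_response n (-t) ht' z hz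
  have h3 : (fun q : Ω × ℝ => 2 * Real.cosh (t * T.WI n 0 q.1 * q.2) - 2)
      = fun q : Ω × ℝ => Real.exp (t * T.WI n 0 q.1 * q.2) - 1
        + (Real.exp (-t * T.WI n 0 q.1 * q.2) - 1) := by
    ext q
    rw [Real.cosh_eq, neg_mul, neg_mul]
    ring
  have i1 : Integrable (fun q : Ω × ℝ => Real.exp (t * T.WI n 0 q.1 * q.2) - 1)
      (P.prod (κ z)) := h1.sub (integrable_const (1 : ℝ))
  have i2 : Integrable (fun q : Ω × ℝ => Real.exp (-t * T.WI n 0 q.1 * q.2) - 1)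
      (P.prod (κ z)) := h2.sub (integrable_const (1 : ℝ))
  constructor
  · rw [h3]; exact i1.add i2
  · rw [h3, integral_add i1 i2, integral_sub h1 (integrable_const _),
      integral_sub h2 (integrable_const _)]
    simp [condMGF]

/-- Converse of the tangent bound `mul_condMean_le_condMGF`, up to an error quadratic in `t`. The
two together recover the mean from the transform as `t → 0`. -/
theorem condMGF_le_add_sq {z : Fin d → ℝ} (hz : z ∈ Set.Icc (0 : Fin d → ℝ) 1) (n : ℕ)
    {t t₀ : ℝ} (ht₀ : 0 < t₀) (ht₀c : t₀ < c) (ht : |t| ≤ t₀ / 2) :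
    T.condMGF P κ n t z - 1 ≤ t * (T.meanWeight P n * ∫ y, y ∂(κ z))
      + 16 * (t / t₀) ^ 2 * (T.condMGF P κ n t₀ z - 1 + (T.condMGF P κ n (-t₀) z - 1)) := by
  obtain ⟨h1, h2⟩ := integral_WI_mul_response hh hw hc hmgf hcov hz n
  obtain ⟨h3, h4⟩ := integral_cosh_eq hmgf hz n (t := t₀) ⟨by linarith, ht₀c⟩
  have htc : t ∈ Set.Ioo (-c) c := abs_lt.1 (by linarith)
  have hr : |t / t₀| ≤ 1 / 2 := by
    rw [abs_div, abs_of_pos ht₀, div_le_iff₀ ht₀]; linarith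
  have i1 : Integrable (fun q : Ω × ℝ => 1 + t * (T.WI n 0 q.1 * q.2)) (P.prod (κ z)) :=
    (integrable_const 1).add (h1.const_mul t)
  have h5 : T.condMGF P κ n t z ≤ ∫ q : Ω × ℝ, (1 + t * (T.WI n 0 q.1 * q.2)
      + 16 * (t / t₀) ^ 2 * (2 * Real.cosh (t₀ * T.WI n 0 q.1 * q.2) - 2)) ∂(P.prod (κ z)) := by
    refine integral_mono (hmgf.exists_response n t htc z hz)
      (i1.add (h3.const_mul _)) fun q => ?_
    have h6 := exp_mul_le_one_add_mul_add_cosh (r := t / t₀)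
      (v := t₀ * T.WI n 0 q.1 * q.2) hr
    have h7 : t / t₀ * (t₀ * T.WI n 0 q.1 * q.2) = t * (T.WI n 0 q.1 * q.2) := by field_simp
    rw [h7] at h6
    simpa only [mul_assoc] using h6
  rw [integral_add i1 (h3.const_mul _), integral_add (integrable_const 1) (h1.const_mul t), integral_const_mul, integral_const_mul,
    h2, h4] at h5
  simp only [integral_const, probReal_univ, one_smul] at h5
  linarith

omit [MeasurableSpace Θ] [IsProbabilityMeasure P] [IsMarkovKernel κ] hh hw hc hcov in
theorem exists_condMGF_bound {t : ℝ} (ht : t ∈ Set.Ioo (-c) c) : ∃ K : ℝ, 0 < K ∧ ∀ n,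
    (T.condMGF P κ n t x - 1) / T.meanWeight P n
      + (T.condMGF P κ n (-t) x - 1) / T.meanWeight P n ≤ K ∧
    (T.condMGF P κ n t x - 1) / T.meanWeight P n ≤ K ∧
      (T.condMGF P κ n (-t) x - 1) / T.meanWeight P n ≤ K := by
  have ht' : -t ∈ Set.Ioo (-c) c := ⟨by linarith [ht.2], by linarith [ht.1]⟩
  obtain ⟨K₁, h₁⟩ := hmgf.bounded_response t ht
  obtain ⟨K₂, h₂⟩ := hmgf.bounded_response (-t) ht'
  refine ⟨|K₁| + |K₂| + 1, by positivity, fun n => ?_⟩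
  have e₁ := h₁ (Set.mem_range_self n)
  have e₂ := h₂ (Set.mem_range_self n)
  have := le_abs_self K₁
  have := le_abs_self K₂
  have := abs_nonneg K₁
  have := abs_nonneg K₂
  exact ⟨by linarith, by linarith, by linarith⟩

variable {B : ℕ → Box d}
  (hB : ∀ n j, 0 ≤ (B n).lower j ∧ (B n).lower j ≤ x j ∧ x j ≤ (B n).upper j
    ∧ (B n).upper j ≤ 1)
  (havg : ∀ q : ℚ, (q : ℝ) ∈ Set.Ioo (-c) c →
    (∀ᶠ n in atTop, IntegrableOn
      (fun z => (T.condMGF P κ n q z - 1) / T.meanWeight P n * f z) (B n).toSet) ∧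
    Tendsto (fun n => 1 / (B n).vol * (∫ z in (B n).toSet,
        (T.condMGF P κ n q z - 1) / T.meanWeight P n * f z)
      - (T.condMGF P κ n q x - 1) / T.meanWeight P n * f x) atTop (𝓝 0))
include hB havg

/-- The mean response in the box is close to the mean response at `x`. -/
theorem eventually_setIntegral_condMean_le (hx : x ∈ Set.Icc (0 : Fin d → ℝ) 1)
    (hsum : Tendsto (fun n => T.nI n * T.meanWeight P n) atTop atTop)
    (hbal : ∀ j, ∀ᵐ ω ∂P, Tendsto (fun n => T.stripCount j n (B n) (T.predictionData ω)
      / (T.nI n * T.meanWeight P n)) atTop (𝓝 0))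
    {s δ : ℝ} (hs : s = 1 ∨ s = -1) (hδ : 0 < δ) :
    ∀ᶠ n in atTop, s * ∫ z in (B n).toSet, (∫ y, y ∂(κ z)) ∂(covariateLaw f)
      ≤ (s * (∫ y, y ∂(κ x)) + δ) * (covariateLaw f).real (B n).toSet := by
  have := isProbabilityMeasure_jointLaw hh
  have : IsProbabilityMeasure (covariateLaw f) :=
    isProbabilityMeasure_covariateLaw (f := f) (κ := κ)
  obtain ⟨ε, C, hε, hfb⟩ := hcov.bounds
  obtain ⟨q₀, hq₀, hq₀c⟩ := exists_rat_btwn hc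
  have hfx := hcov.density_pos hx
  have hq₀m : (q₀ : ℝ) ∈ Set.Ioo (-c) c := ⟨by linarith, hq₀c⟩
  obtain ⟨K, hK0, hK⟩ := exists_condMGF_bound hmgf hq₀m
  set A : ℝ := s * ∫ y, y ∂(κ x) with hA
  -- Error budget per unit volume: `2 δ' = δ ε / 2` from the transforms and `|A| η ≤ δ ε / 2` from
  -- the variation of the density. The total `δ ε` is at most `δ` times the mass per unit volume.
  set δ' : ℝ := δ * ε / 4 with hδ'
  have hδ'0 : 0 < δ' := by positivity
  -- The parameter is fixed before `n` grows: after division by `t` the quadratic error is at most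
  -- `δ'`, and the averaging error, made smaller than `t * δ'` for large `n`, contributes another
  -- `δ'`.
  obtain ⟨t, ht0, htm⟩ := exists_rat_btwn
    (show (0 : ℝ) < min ((q₀ : ℝ) / 2) (δ' * q₀ ^ 2 / (16 * (f x * K))) by positivity)
  have ht1 : (t : ℝ) ≤ q₀ / 2 := htm.le.trans (min_le_left _ _)
  have ht2 : 16 * ((t : ℝ) / q₀ ^ 2) * K * f x ≤ δ' := by
    have h1 := htm.le.trans (min_le_right _ _)
    rw [le_div_iff₀ (by positivity)] at h1
    rw [show 16 * ((t : ℝ) / q₀ ^ 2) * K * f x = t * (16 * (f x * K)) / q₀ ^ 2 by ring,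
      div_le_iff₀ (by positivity)]
    exact h1
  obtain ⟨q, hq⟩ : ∃ q : ℚ, (q : ℝ) = s * t := by
    rcases hs with rfl | rfl
    · exact ⟨t, by simp⟩
    · exact ⟨-t, by simp⟩
  have hs2 : s * s = 1 := by rcases hs with rfl | rfl <;> norm_num
  have hqabs : |(q : ℝ)| = t := by
    rw [hq, abs_mul, abs_of_pos ht0]
    rcases hs with rfl | rfl <;> simp
  have hqm : (q : ℝ) ∈ Set.Ioo (-c) c := abs_lt.1 (by rw [hqabs]; linarith)
  obtain ⟨hint, hlim⟩ := havg q hqm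
  set η : ℝ := δ * ε / (2 * (|A| + 1)) with hη
  have hη0 : 0 < η := by positivity
  filter_upwards [hint, hlim.eventually (gt_mem_nhds (show (0 : ℝ) < t * δ' by positivity)),
    hsum.eventually_gt_atTop 0,
    eventually_abs_density_sub_le hh hw hc hmgf hcov hB hsum hbal hx hη0]
    with n hn1 hn2 hn3 hn4
  have hμ : 0 < T.meanWeight P n := by
    have := meanWeight_nonneg hw hh.nI_pos n
    rcases this.eq_or_lt with h | h
    · rw [← h] at hn3; simp at hn3
    · exact h
  set S := (B n).toSet with hS
  have hSm : MeasurableSet S := (B n).measurableSet_toSet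
  have hSI : S ⊆ Set.Icc 0 1 :=
    Box.toSet_subset_Icc fun j => ⟨(hB n j).1, (hB n j).2.2.2⟩
  have hBle : ∀ j, (B n).lower j ≤ (B n).upper j := fun j => (hB n j).2.1.trans (hB n j).2.2.1
  have hvol : volume.real S = (B n).vol := Box.real_volume_toSet hBle
  have hvol0 : 0 ≤ (B n).vol := Box.vol_nonneg hBle
  have hfint : IntegrableOn f S := hcov.integrableOn_density hSI
  have hmint : IntegrableOn (fun z => (∫ y, y ∂(κ z)) * f z) S :=
    (hcov.integrableOn_covariateLaw_iff hSm hSI _).1 hcov.integrable_condMean.integrableOn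
  -- comparison with the moment generating functions
  have h1 : q * ∫ z in S, (∫ y, y ∂(κ z)) * f z
      ≤ ∫ z in S, (T.condMGF P κ n q z - 1) / T.meanWeight P n * f z := by
    rw [← integral_const_mul]
    refine setIntegral_mono_on (hmint.const_mul _) hn1 hSm fun z hz => ?_
    have h2 := mul_condMean_le_condMGF hh hw hc hmgf hcov (hSI hz) n hqm
    rw [← mul_assoc]
    refine mul_le_mul_of_nonneg_right ?_ (hcov.density_pos (hSI hz)).le
    rw [le_div_iff₀ hμ]
    linarith
  rw [Box.setIntegral_eq_vol_mul_average hBle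
    fun z => (T.condMGF P κ n q z - 1) / T.meanWeight P n * f z] at h1
  have h2 : (T.condMGF P κ n q x - 1) / T.meanWeight P n
      ≤ q * (∫ y, y ∂(κ x)) + 16 * ((t : ℝ) / q₀) ^ 2 * K := by
    have h3 := condMGF_le_add_sq hh hw hc hmgf hcov hx n hq₀ hq₀c (t := q)
      (by rw [hqabs]; exact ht1)
    have h4 := (hK n).1
    rw [← add_div, div_le_iff₀ hμ] at h4
    have h5 : ((q : ℝ) / q₀) ^ 2 = ((t : ℝ) / q₀) ^ 2 := by
      rw [div_pow, div_pow, ← sq_abs (q : ℝ), hqabs]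
    rw [h5] at h3
    rw [div_le_iff₀ hμ]
    have h6 := mul_le_mul_of_nonneg_left h4 (show 0 ≤ 16 * ((t : ℝ) / q₀) ^ 2 by positivity)
    linarith
  have h3 : q * ∫ z in S, (∫ y, y ∂(κ z)) * f z
      ≤ (B n).vol * ((q * (∫ y, y ∂(κ x)) + 16 * ((t : ℝ) / q₀) ^ 2 * K) * f x + t * δ') := by
    refine h1.trans (mul_le_mul_of_nonneg_left ?_ hvol0)
    have := mul_le_mul_of_nonneg_right h2 hfx.le
    linarith
  have h4 : s * ∫ z in S, (∫ y, y ∂(κ z)) * f z ≤ (B n).vol * (A * f x + 2 * δ') := by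
    have h5 : (t : ℝ) * (s * ∫ z in S, (∫ y, y ∂(κ z)) * f z)
        ≤ t * ((B n).vol * (A * f x + 16 * ((t : ℝ) / q₀ ^ 2) * K * f x + δ')) := by
      calc (t : ℝ) * (s * ∫ z in S, (∫ y, y ∂(κ z)) * f z)
          = q * ∫ z in S, (∫ y, y ∂(κ z)) * f z := by rw [hq]; ring
        _ ≤ _ := h3
        _ = _ := by rw [hq, hA]; ring
    have h6 := le_of_mul_le_mul_left h5 ht0
    refine h6.trans (mul_le_mul_of_nonneg_left ?_ hvol0)
    linarith
  rw [hcov.setIntegral_covariateLaw hSm hSI, hcov.real_covariateLaw hSm hSI]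
  refine h4.trans ?_
  -- the mass of the box
  have hconst : ∀ a : ℝ, ∫ _z in S, a = (B n).vol * a := by
    intro a
    rw [setIntegral_const, hvol, smul_eq_mul]
  have hcint : ∀ a : ℝ, IntegrableOn (fun _ : Fin d → ℝ => a) S := fun a =>
    integrableOn_const (B n).volume_toSet_ne_top
  have h5 : (B n).vol * ε ≤ ∫ z in S, f z := by
    rw [← hconst]
    exact setIntegral_mono_on (hcint _) hfint hSm fun z hz => (hfb z (hSI hz)).1
  have h6 : |(∫ z in S, f z) - (B n).vol * f x| ≤ (B n).vol * η := by
    rw [abs_le]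
    constructor
    · have : (B n).vol * (f x - η) ≤ ∫ z in S, f z := by
        rw [← hconst]
        exact setIntegral_mono_on (hcint _) hfint hSm fun z hz => by
          linarith [(abs_le.1 (hn4 z hz)).1]
      linarith
    · have : ∫ z in S, f z ≤ (B n).vol * (f x + η) := by
        rw [← hconst]
        exact setIntegral_mono_on hfint (hcint _) hSm fun z hz => by
          linarith [(abs_le.1 (hn4 z hz)).2]
      linarith
  have h7 : -(|A| * ((B n).vol * η)) ≤ A * ((∫ z in S, f z) - (B n).vol * f x) := by
    refine le_trans (neg_le_neg ?_) (neg_abs_le _)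
    rw [abs_mul]
    exact mul_le_mul_of_nonneg_left h6 (abs_nonneg A)
  have h8 : |A| * η ≤ δ * ε / 2 := by
    rw [hη, mul_div_assoc', div_le_div_iff₀ (by positivity) (by norm_num)]
    nlinarith [abs_nonneg A, mul_pos hδ hε]
  have h9 := mul_le_mul_of_nonneg_left h8 hvol0
  have h10 := mul_le_mul_of_nonneg_left h5 hδ.le
  simp only [hδ']
  linarith

end CondMGF

end BootstrapTree

/-! ### Tail and summability estimates -/

theorem measure_lt_le_fourth_moment {Ω : Type*} [MeasurableSpace Ω] {P : Measure Ω}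
    [IsProbabilityMeasure P] {W : Ω → ℝ} {μ v : ℝ} (hint : Integrable (fun ω => (W ω - μ) ^ 4) P)
    (hv : 0 < v) (hμ : μ ≤ v / 2) :
    P {ω | v < W ω} ≤ ENNReal.ofReal ((2 / v) ^ 4 * ∫ ω, (W ω - μ) ^ 4 ∂P) := by
  have h1 := mul_meas_ge_le_integral_of_nonneg
    (ae_of_all _ fun ω => (by positivity : 0 ≤ (W ω - μ) ^ 4)) hint ((v / 2) ^ 4)
  have h2 : {ω | v < W ω} ⊆ {ω | (v / 2) ^ 4 ≤ (W ω - μ) ^ 4} := by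
    intro ω hω
    rw [Set.mem_ofPred_eq] at hω ⊢
    gcongr
    linarith
  refine (measure_mono h2).trans ?_
  rw [← ENNReal.ofReal_toReal (measure_ne_top P _)]
  refine ENNReal.ofReal_le_ofReal ?_
  rw [show (2 / v) ^ 4 = ((v / 2) ^ 4)⁻¹ by rw [← inv_pow, inv_div], le_inv_mul_iff₀ (by positivity)]
  exact h1

/-- The numerator `k ^ 2` arises from `8 nI μ ≤ k ^ 2`; half of the exponential decay absorbs it and
the other half is summable. -/
theorem summable_sq_div_cosh {k : ℕ → ℝ} (hk : Tendsto k atTop atTop)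
    (hsum : ∀ δ : ℝ, 0 < δ → Summable (fun n => Real.exp (-δ * k n))) {a : ℝ} (ha : 0 < a) :
    Summable fun n => k n ^ 2 / (2 * Real.cosh (a * k n) - 2) := by
  refine Summable.of_norm_bounded_eventually_nat ((hsum (a / 2) (by positivity)).mul_left 2) ?_
  have h1 : Tendsto (fun u : ℝ => u ^ 2 * Real.exp (-(a / 2) * u)) atTop (𝓝 0) := by
    have h := Real.tendsto_pow_mul_exp_neg_atTop_nhds_zero 2
    have h2 := (h.comp (tendsto_id.const_mul_atTop (show 0 < a / 2 by positivity))).const_mul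
      ((2 / a) ^ 2)
    rw [mul_zero] at h2
    refine h2.congr fun u => ?_
    simp only [Function.comp, id]
    rw [neg_mul]
    field_simp
  filter_upwards [(h1.comp hk).eventually (gt_mem_nhds one_pos), hk.eventually_gt_atTop 0,
    hk.eventually_ge_atTop (4 / a)] with n h1 h2 h3
  simp only [Function.comp] at h1
  have h4 : 4 ≤ a * k n := by rw [div_le_iff₀ ha] at h3; linarith
  have h5 : Real.exp (a * k n) / 2 ≤ 2 * Real.cosh (a * k n) - 2 := by
    rw [Real.cosh_eq]
    linarith [Real.add_one_le_exp (a * k n), Real.exp_pos (-(a * k n))]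
  have h6 : 0 < Real.exp (a * k n) / 2 := by positivity
  rw [Real.norm_eq_abs, abs_of_nonneg (div_nonneg (sq_nonneg _) (h6.le.trans h5)),
    div_le_iff₀ (h6.trans_le h5)]
  have h7 : k n ^ 2 ≤ Real.exp (a / 2 * k n) := by
    rw [neg_mul, Real.exp_neg, ← div_eq_mul_inv, div_lt_one (Real.exp_pos _)] at h1
    exact h1.le
  calc k n ^ 2 ≤ Real.exp (a / 2 * k n) := h7
    _ = 2 * Real.exp (-(a / 2) * k n) * (Real.exp (a * k n) / 2) := by
        rw [show 2 * Real.exp (-(a / 2) * k n) * (Real.exp (a * k n) / 2)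
          = Real.exp (-(a / 2) * k n) * Real.exp (a * k n) by ring, ← Real.exp_add]
        congr 1
        ring
    _ ≤ _ := by gcongr

namespace BootstrapTree

variable {Ω Θ : Type*} {d : ℕ} [MeasurableSpace Ω] [MeasurableSpace Θ]
  {T : BootstrapTree Ω Θ d} {P : Measure Ω} [IsProbabilityMeasure P]
  {f : (Fin d → ℝ) → ℝ} {κ : Kernel (Fin d → ℝ) ℝ} [IsMarkovKernel κ] {x : Fin d → ℝ} {c : ℝ}

/-! ### Tails of the weighted responses -/

omit [MeasurableSpace Θ] in
-- Markov's inequality for `2 cosh - 2` rather than `exp`: it vanishes at zero, so the numerator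
-- involves transforms minus one, retaining the factor `μ` once they are normalized.
theorem measure_weighted_response_gt (hmgf : T.MGFAssumption P f κ x c)
    {z : Fin d → ℝ} (hz : z ∈ Set.Icc (0 : Fin d → ℝ) 1) (n : ℕ)
    {t v : ℝ} (ht : t ∈ Set.Ioo (-c) c) (ht0 : 0 < t) (hv : 0 < v) :
    (P.prod (κ z)) {q | v < |T.WI n 0 q.1 * q.2|} ≤ ENNReal.ofReal
      ((T.condMGF P κ n t z - 1 + (T.condMGF P κ n (-t) z - 1))
        / (2 * Real.cosh (t * v) - 2)) := by
  obtain ⟨h1, h2⟩ := integral_cosh_eq hmgf hz n ht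
  have hD : 0 < 2 * Real.cosh (t * v) - 2 := by
    have := Real.one_lt_cosh.2 (mul_pos ht0 hv).ne'
    linarith
  have h3 := mul_meas_ge_le_integral_of_nonneg
    (ae_of_all _ fun q => by
      have := Real.one_le_cosh (t * T.WI n 0 q.1 * q.2)
      simp only [Pi.zero_apply]
      linarith) h1 (2 * Real.cosh (t * v) - 2)
  rw [h2] at h3
  have h4 : {q : Ω × ℝ | v < |T.WI n 0 q.1 * q.2|}
      ⊆ {q | 2 * Real.cosh (t * v) - 2 ≤ 2 * Real.cosh (t * T.WI n 0 q.1 * q.2) - 2} := by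
    intro q hq
    rw [Set.mem_ofPred_eq] at hq ⊢
    have : Real.cosh (t * v) ≤ Real.cosh (t * T.WI n 0 q.1 * q.2) := by
      rw [Real.cosh_le_cosh, mul_assoc, abs_mul, abs_mul, abs_of_pos ht0, abs_of_pos hv]
      exact mul_le_mul_of_nonneg_left hq.le ht0.le
    linarith
  refine (measure_mono h4).trans ?_
  rw [← ENNReal.ofReal_toReal (measure_ne_top (P.prod (κ z)) _)]
  refine ENNReal.ofReal_le_ofReal ?_
  rw [le_div_iff₀ hD, mul_comm]
  exact h3

theorem measure_localized_weighted_response_gt (hh : T.Honest P f κ)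
    (hw : T.WeightAssumption P) {n i : ℕ} (hi : i < T.nI n) {S : Set (Fin d → ℝ)}
    (hS : MeasurableSet S) (v : ℝ) :
    P {ω | (T.ZI i ω).1 ∈ S ∧ v < |T.WI n i ω * (T.ZI i ω).2|}
      = ∫⁻ z in S, (P.prod (κ z)) {q | v < |T.WI n 0 q.1 * q.2|} ∂(covariateLaw f) := by
  have hW := hw.measurable_WI n i hi
  have hW0 := hw.measurable_WI n 0 (hh.nI_pos n)
  have hE : MeasurableSet {p : ((Fin d → ℝ) × ℝ) × ℝ | p.1.1 ∈ S ∧ v < |p.2 * p.1.2|} := by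
    rw [Set.ofPred_and]
    refine (hS.preimage (measurable_fst.comp measurable_fst)).inter
      (measurableSet_lt measurable_const ?_)
    exact (measurable_snd.mul (measurable_snd.comp measurable_fst)).norm
  have h1 : P {ω | (T.ZI i ω).1 ∈ S ∧ v < |T.WI n i ω * (T.ZI i ω).2|}
      = ((jointLaw f κ).prod (P.map (T.WI n 0)))
        {p : ((Fin d → ℝ) × ℝ) × ℝ | p.1.1 ∈ S ∧ v < |p.2 * p.1.2|} := by
    have h2 := (indepFun_iff_map_prod_eq_prod_map_map (hh.measurable_ZI i).aemeasurable
      hW.aemeasurable).1 (indepFun_WI_ZI hw hi i).symm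
    rw [hh.law_ZI, (hw.identDistrib_WI hi).map_eq] at h2
    rw [← h2, Measure.map_apply ((hh.measurable_ZI i).prodMk hW) hE]
    rfl
  have : IsProbabilityMeasure (P.map (T.WI n 0)) :=
    Measure.isProbabilityMeasure_map hW0.aemeasurable
  have hm := measurable_measure_prodMk_left (ν := P.map (T.WI n 0)) hE
  rw [h1, Measure.prod_apply hE, jointLaw_eq, Measure.lintegral_compProd hm,
    ← lintegral_indicator hS]
  refine lintegral_congr fun z => ?_
  by_cases hz : z ∈ S
  · have hE' : MeasurableSet {q : Ω × ℝ | v < |T.WI n 0 q.1 * q.2|} :=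
      measurableSet_lt measurable_const ((hW0.comp measurable_fst).mul measurable_snd).norm
    rw [Set.indicator_of_mem hz, Measure.prod_apply_symm hE']
    refine lintegral_congr fun y => ?_
    rw [Measure.map_apply hW0 (measurable_prodMk_left hE)]
    congr 1
    ext ω
    simp [hz]
  · rw [Set.indicator_of_notMem hz]
    simp [hz]

theorem measure_localized_weighted_response_gt_le (hh : T.Honest P f κ)
    (hw : T.WeightAssumption P) (hmgf : T.MGFAssumption P f κ x c)
    (hcov : CovariateAssumption f κ) {n i : ℕ} (hi : i < T.nI n) {S : Set (Fin d → ℝ)}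
    (hS : MeasurableSet S) (hSI : S ⊆ Set.Icc 0 1) {t v : ℝ} (ht : t ∈ Set.Ioo (-c) c)
    (ht0 : 0 < t) (hv : 0 < v) (hμ : 0 < T.meanWeight P n)
    (hi1 : IntegrableOn (fun z => (T.condMGF P κ n t z - 1) / T.meanWeight P n * f z) S)
    (hi2 : IntegrableOn (fun z => (T.condMGF P κ n (-t) z - 1) / T.meanWeight P n * f z) S) :
    P {ω | (T.ZI i ω).1 ∈ S ∧ v < |T.WI n i ω * (T.ZI i ω).2|}
      ≤ ENNReal.ofReal (T.meanWeight P n / (2 * Real.cosh (t * v) - 2) *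
        ((∫ z in S, (T.condMGF P κ n t z - 1) / T.meanWeight P n * f z)
          + ∫ z in S, (T.condMGF P κ n (-t) z - 1) / T.meanWeight P n * f z)) := by
  have hD : 0 < 2 * Real.cosh (t * v) - 2 := by
    have := Real.one_lt_cosh.2 (mul_pos ht0 hv).ne'
    linarith
  set h : (Fin d → ℝ) → ℝ := fun z =>
    (T.condMGF P κ n t z - 1 + (T.condMGF P κ n (-t) z - 1))
      / (2 * Real.cosh (t * v) - 2) with hh'
  have hfun : (fun z => h z * f z) = fun z => T.meanWeight P n / (2 * Real.cosh (t * v) - 2) *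
      ((T.condMGF P κ n t z - 1) / T.meanWeight P n * f z
        + (T.condMGF P κ n (-t) z - 1) / T.meanWeight P n * f z) := by
    ext z
    simp only [hh']
    field_simp
  have hint : IntegrableOn h S (covariateLaw f) := by
    rw [hcov.integrableOn_covariateLaw_iff hS hSI, hfun]
    exact (hi1.add hi2).const_mul _
  have hpos : ∀ z ∈ S, 0 ≤ h z := by
    intro z hz
    refine div_nonneg ?_ hD.le
    rw [← (integral_cosh_eq hmgf (hSI hz) n ht).2]
    refine integral_nonneg fun q => ?_
    have := Real.one_le_cosh (t * T.WI n 0 q.1 * q.2)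
    simp only [Pi.zero_apply]
    linarith
  rw [measure_localized_weighted_response_gt hh hw hi hS]
  calc ∫⁻ z in S, (P.prod (κ z)) {q | v < |T.WI n 0 q.1 * q.2|} ∂(covariateLaw f)
      ≤ ∫⁻ z in S, ENNReal.ofReal (h z) ∂(covariateLaw f) :=
        setLIntegral_mono' hS fun z hz => measure_weighted_response_gt hmgf (hSI hz) n ht ht0 hv
    _ = ENNReal.ofReal (∫ z in S, h z ∂(covariateLaw f)) := by
        rw [ofReal_integral_eq_lintegral_ofReal hint]
        filter_upwards [ae_restrict_mem hS] with z hz using hpos z hz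
    _ = _ := by
        rw [hcov.setIntegral_covariateLaw hS hSI, hfun, integral_const_mul,
          integral_add hi1 hi2]

/-! ### Strong consistency for deterministic boxes -/

section Consistency

variable (hh : T.Honest P f κ) (hw : T.WeightAssumption P) (hc : 0 < c)
  (hmgf : T.MGFAssumption P f κ x c) (hcov : CovariateAssumption f κ) {k : ℕ → ℝ}
  {B : ℕ → Box d}
include hh hw hc hmgf hcov

/-- The large deviation bound at a single stage. -/
theorem measure_deviation_le {n : ℕ} {B : Box d}
    (hSI : B.toSet ⊆ Set.Icc 0 1) {s δ m k K t : ℝ} (hs : s * s = 1) (hδ : 0 < δ) (hk : 0 < k)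
    (hK0 : 0 ≤ K) (hK : ∀ z ∈ Set.Icc (0 : Fin d → ℝ) 1, ∫ y, y ^ 2 ∂(κ z) ≤ K)
    (hμ : 0 < T.meanWeight P n) (ht : t ∈ Set.Ioo (-c) c) (ht0 : 0 < t)
    (hi1 : IntegrableOn (fun z => (T.condMGF P κ n t z - 1) / T.meanWeight P n * f z) B.toSet)
    (hi2 : IntegrableOn (fun z => (T.condMGF P κ n (-t) z - 1) / T.meanWeight P n * f z) B.toSet)
    (hbias : s * ∫ z in B.toSet, (∫ y, y ∂(κ z)) ∂(covariateLaw f)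
      ≤ (s * m + δ / 4) * (covariateLaw f).real B.toSet)
    (hμk : T.meanWeight P n ≤ δ * k / (64 * (|s * m + 3 * δ / 4| + 1)) / 2) :
    P {ω | k ≤ T.boxCount n B (T.predictionData ω) ∧ 0 ≤ ∑ i : Fin (T.nI n), T.WI n i ω *
        (B.toSet.indicator (fun _ => (1 : ℝ)) (T.ZI i ω).1 * (s * ((T.ZI i ω).2 - m) - δ))}
      ≤ ENNReal.ofReal (T.nI n * (T.meanWeight P n / (2 * Real.cosh (t * (δ * k / 64)) - 2) *
          ((∫ z in B.toSet, (T.condMGF P κ n t z - 1) / T.meanWeight P n * f z)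
            + ∫ z in B.toSet, (T.condMGF P κ n (-t) z - 1) / T.meanWeight P n * f z)))
        + ENNReal.ofReal (T.nI n * ((2 / (δ * k / (64 * (|s * m + 3 * δ / 4| + 1)))) ^ 4 *
          ∫ ω, (T.WI n 0 ω - T.meanWeight P n) ^ 4 ∂P))
        + ENNReal.ofReal (((2 * K + 2 * (s * m + 3 * δ / 4) ^ 2 + 1)
          / (δ / 2 * (δ / 4 / 8) * k)) ^ 4 * (8 * T.meanWeight P n ^ 4
            + 8 * (T.nI n * ∫ ω, (T.WI n 0 ω - T.meanWeight P n) ^ 4 ∂P))) := by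
  have hprob := isProbabilityMeasure_jointLaw hh
  have : IsProbabilityMeasure (covariateLaw f) :=
    isProbabilityMeasure_covariateLaw (f := f) (κ := κ)
  set S := B.toSet with hSdef
  have hS : MeasurableSet S := B.measurableSet_toSet
  -- Of the tolerance `δ`, a quarter goes to the bias and half to the negative drift `-(δ / 2) p`;
  -- the remaining quarter, multiplied by the leaf count, gives the level `δ / 4 * k`.
  set b : ℝ := s * m + 3 * δ / 4 with hb
  set p : ℝ := (covariateLaw f).real S with hp
  have hp0 : 0 ≤ p := measureReal_nonneg
  set g : (Fin d → ℝ) × ℝ → ℝ := fun q => S.indicator (fun _ => (1 : ℝ)) q.1 * (s * q.2 - b)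
    with hg
  have hgm : Measurable g := CovariateAssumption.measurable_localized hS
  have hg1 := hcov.integrable_localized hS hs (b := b)
  have hg2 := hcov.integrable_sq_localized hS hs (b := b)
  have hm : ∫ q, g q ∂(jointLaw f κ) ≤ -(δ / 2 * p) := by
    rw [hg, hcov.integral_localized hS hs]
    simp only [hb, ← hp]
    linarith
  have hv : ∫ q, g q ^ 2 ∂(jointLaw f κ) ≤ (2 * K + 2 * b ^ 2 + 1) * p := by
    have := hcov.integral_sq_localized_le hS hs (b := b) hK
    rw [← hp] at this
    linarith
  have h4 : ∀ i : Fin (T.nI n), Integrable (fun ω => (T.WI n i ω - T.meanWeight P n) ^ 4) P ∧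
      ∫ ω, (T.WI n i ω - T.meanWeight P n) ^ 4 ∂P
        = ∫ ω, (T.WI n 0 ω - T.meanWeight P n) ^ 4 ∂P := fun i =>
    ⟨integrable_sub_pow_four hw hc hmgf i.2 _,
      ((hw.identDistrib_WI i.2).comp
        ((measurable_id.sub_const (T.meanWeight P n)).pow_const 4)).integral_eq⟩
  have hWZ : IndepFun (fun ω (i : Fin (T.nI n)) => T.WI n i ω)
      (fun ω (i : Fin (T.nI n)) => T.ZI i ω) P :=
    (indepFun_weightsI_sampleI hw).comp
      (show Measurable fun q : (n : ℕ) → Fin (T.nI n) → ℝ => q n by fun_prop)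
      (show Measurable fun (q : ℕ → (Fin d → ℝ) × ℝ) (i : Fin (T.nI n)) => q i by fun_prop)
  have hind : iIndepFun (fun i : Fin (T.nI n) => T.ZI i) P :=
    hh.indep_observations.precomp (g := fun i : Fin (T.nI n) => Sum.inl (i : ℕ))
      (Sum.inl_injective.comp Fin.val_injective)
  have key := measure_random_weighted_sum_ge_le (fun i : Fin (T.nI n) => hh.measurable_ZI i) hind
    (fun i => hh.law_ZI i) hgm hg1 hg2 hp0 (show 0 < 2 * K + 2 * b ^ 2 + 1 by positivity)
    (half_pos hδ) hk (show 0 < δ / 4 by positivity) hμ hm hv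
    (fun i : Fin (T.nI n) => hw.measurable_WI n i i.2) (fun i => hw.nonneg_WI n i i.2)
    (fun i => (h4 i).1) hWZ
  have hsub : {ω | k ≤ T.boxCount n B (T.predictionData ω) ∧ 0 ≤ ∑ i : Fin (T.nI n), T.WI n i ω *
      (S.indicator (fun _ => (1 : ℝ)) (T.ZI i ω).1 * (s * ((T.ZI i ω).2 - m) - δ))}
      ⊆ {ω | δ / 4 * k ≤ ∑ i : Fin (T.nI n), T.WI n i ω * g (T.ZI i ω)} := by
    intro ω hω
    rw [Set.mem_ofPred_eq] at hω ⊢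
    have h1 : ∑ i : Fin (T.nI n), T.WI n i ω * g (T.ZI i ω)
        = (∑ i : Fin (T.nI n), T.WI n i ω *
          (S.indicator (fun _ => (1 : ℝ)) (T.ZI i ω).1 * (s * ((T.ZI i ω).2 - m) - δ)))
          + δ / 4 * T.boxCount n B (T.predictionData ω) := by
      unfold boxCount
      rw [Finset.mul_sum, ← Finset.sum_add_distrib]
      refine Finset.sum_congr rfl fun i _ => ?_
      simp only [hg, hb, predictionData, weightsI, ← hSdef]
      ring
    rw [h1]
    have := mul_le_mul_of_nonneg_left hω.1 (show 0 ≤ δ / 4 by positivity)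
    linarith [hω.2]
  refine (measure_mono hsub).trans (key.trans ?_)
  have hsum4 : ∑ i : Fin (T.nI n), ∫ ω, (T.WI n i ω - T.meanWeight P n) ^ 4 ∂P
      = T.nI n * ∫ ω, (T.WI n 0 ω - T.meanWeight P n) ^ 4 ∂P := by
    rw [Finset.sum_congr rfl fun i _ => (h4 i).2]
    simp
  rw [hsum4]
  refine add_le_add_left ?_ _
  set v : ℝ := δ * k / 64 with hvdef
  have hv0 : 0 < v := by positivity
  -- The jump threshold `δ k / 32` is halved between `W s Y` and `-W b`; the `+ 1` beside `|b|`
  -- keeps the weight threshold finite when `b = 0`.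
  have hterm : ∀ i : Fin (T.nI n), P {ω | δ / 4 / 8 * k < T.WI n i ω * g (T.ZI i ω)}
      ≤ P {ω | (T.ZI i ω).1 ∈ S ∧ v < |T.WI n i ω * (T.ZI i ω).2|}
        + P {ω | δ * k / (64 * (|b| + 1)) < T.WI n i ω} := by
    intro i
    refine le_trans (measure_mono_ae ?_) (measure_union_le _ _)
    filter_upwards [hw.nonneg_WI n i i.2] with ω hω0 hω
    have hω : δ / 4 / 8 * k < T.WI n i ω * g (T.ZI i ω) := hω
    by_cases hz : (T.ZI i ω).1 ∈ S
    · by_contra hcon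
      rw [show ∀ A A' : Set Ω, (A ∪ A') ω ↔ ω ∈ A ∨ ω ∈ A' from fun _ _ => Iff.rfl] at hcon
      push Not at hcon
      obtain ⟨hc1, hc2⟩ := hcon
      have hc1 : |T.WI n i ω * (T.ZI i ω).2| ≤ v := by
        by_contra h
        exact hc1 ⟨hz, lt_of_not_ge h⟩
      have hc2 : T.WI n i ω ≤ δ * k / (64 * (|b| + 1)) := not_lt.1 hc2
      simp only [hg, Set.indicator_of_mem hz, one_mul] at hω
      have hs1 : |s| = 1 := by
        have := abs_mul_abs_self s
        nlinarith [abs_nonneg s]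
      have e1 : s * (T.WI n i ω * (T.ZI i ω).2) ≤ v := by
        refine (le_abs_self _).trans ?_
        rw [abs_mul, hs1, one_mul]
        exact hc1
      have e2 : -(T.WI n i ω * b) ≤ v := by
        have e3 : T.WI n i ω * (|b| + 1) ≤ v := by
          rw [le_div_iff₀ (by positivity)] at hc2
          rw [hvdef]
          linarith
        have e4 := mul_le_mul_of_nonneg_left (neg_abs_le b) hω0
        linarith
      rw [hvdef] at e1 e2
      linarith
    · simp only [hg, Set.indicator_of_notMem hz, zero_mul, mul_zero] at hω
      exact absurd hω (not_lt.2 (by positivity))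
  refine (Finset.sum_le_sum fun i _ => hterm i).trans ?_
  rw [Finset.sum_add_distrib]
  refine add_le_add ?_ ?_
  · refine (Finset.sum_le_sum fun i _ => measure_localized_weighted_response_gt_le hh hw hmgf hcov
      i.2 hS hSI ht ht0 hv0 hμ hi1 hi2).trans (le_of_eq ?_)
    rw [Finset.sum_const, Finset.card_univ, Fintype.card_fin, nsmul_eq_mul,
      ENNReal.ofReal_mul (Nat.cast_nonneg _), ENNReal.ofReal_natCast]
  · refine (Finset.sum_le_sum fun i _ => measure_lt_le_fourth_moment (h4 i).1
      (by positivity) hμk).trans (le_of_eq ?_)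
    rw [Finset.sum_congr rfl fun i _ => by rw [(h4 i).2]]
    rw [Finset.sum_const, Finset.card_univ, Fintype.card_fin, nsmul_eq_mul,
      ENNReal.ofReal_mul (Nat.cast_nonneg _), ENNReal.ofReal_natCast]

end Consistency

end BootstrapTree

/-! ### Borel–Cantelli and almost sure convergence -/

theorem ae_eventually_notMem_of_le_ofReal {Ω : Type*} [MeasurableSpace Ω] {P : Measure Ω}
    [IsFiniteMeasure P] {S : ℕ → Set Ω} {b : ℕ → ℝ} (hb : Summable b) (hb0 : ∀ n, 0 ≤ b n)
    (h : ∀ᶠ n in atTop, P (S n) ≤ ENNReal.ofReal (b n)) :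
    ∀ᵐ ω ∂P, ∀ᶠ n in atTop, ω ∉ S n := by
  have h1 : Summable fun n => P.real (S n) := by
    refine Summable.of_norm_bounded_eventually_nat hb ?_
    filter_upwards [h] with n hn
    rw [Real.norm_eq_abs, abs_of_nonneg measureReal_nonneg]
    exact ENNReal.toReal_le_of_le_ofReal (hb0 n) hn
  refine ae_eventually_notMem ?_
  have h2 := h1.tsum_ofReal_ne_top
  convert h2 using 3
  exact (ENNReal.ofReal_toReal (measure_ne_top P _)).symm

namespace BootstrapTree

variable {Ω Θ : Type*} {d : ℕ} [MeasurableSpace Ω] [MeasurableSpace Θ]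
  {T : BootstrapTree Ω Θ d} {P : Measure Ω} [IsProbabilityMeasure P]
  {f : (Fin d → ℝ) → ℝ} {κ : Kernel (Fin d → ℝ) ℝ} [IsMarkovKernel κ] {x : Fin d → ℝ} {c : ℝ}

omit [MeasurableSpace Ω] [MeasurableSpace Θ] in
-- The sum equals `N (s (mean - m) - δ)`, so a random denominator is traded for a linear statistic.
theorem lt_of_sum_localized_neg {n : ℕ} {B : Box d} {ω : Ω} {s m δ : ℝ}
    (hpos : 0 < T.boxCount n B (T.predictionData ω))
    (h : ∑ i : Fin (T.nI n), T.WI n i ω *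
      (B.toSet.indicator (fun _ => (1 : ℝ)) (T.ZI i ω).1 * (s * ((T.ZI i ω).2 - m) - δ)) < 0) :
    s * (T.boxMean n B (T.predictionData ω) - m) < δ := by
  set N := T.boxCount n B (T.predictionData ω) with hN
  set V := ∑ i : Fin (T.nI n), T.WI n i ω *
    B.toSet.indicator (fun _ => (1 : ℝ)) (T.ZI i ω).1 * (T.ZI i ω).2 with hV
  have h1 : T.boxMean n B (T.predictionData ω) = V / N := by
    unfold boxMean
    rw [hV, Finset.sum_div]
    refine Finset.sum_congr rfl fun i _ => ?_
    change T.WI n i ω * B.toSet.indicator (fun _ => (1 : ℝ)) (T.ZI i ω).1 / N * (T.ZI i ω).2 = _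
    ring
  have h2 : ∑ i : Fin (T.nI n), T.WI n i ω *
      (B.toSet.indicator (fun _ => (1 : ℝ)) (T.ZI i ω).1 * (s * ((T.ZI i ω).2 - m) - δ))
      = s * V - (s * m + δ) * N := by
    rw [hV, hN]
    unfold boxCount
    rw [Finset.mul_sum, Finset.mul_sum, ← Finset.sum_sub_distrib]
    refine Finset.sum_congr rfl fun i _ => ?_
    simp only [predictionData, weightsI]
    ring
  rw [h2] at h
  have h3 : V = V / N * N := by field_simp
  rw [h3] at h
  rw [h1]
  by_contra hcon
  push Not at hcon
  have := mul_le_mul_of_nonneg_right hcon hpos.le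
  linarith

theorem ae_tendsto_boxMean (hd : 0 < d) (hx : x ∈ Set.Icc (0 : Fin d → ℝ) 1)
    (hcov : CovariateAssumption f κ) (hh : T.Honest P f κ) (hw : T.WeightAssumption P)
    {k : ℕ → ℝ} (hsize : T.SummableLeafSize P k)
    (hk : ∀ δ : ℝ, 0 < δ → Summable (fun n => Real.exp (-δ * k n)))
    (hc : 0 < c) (hmgf : T.MGFAssumption P f κ x c) {B : ℕ → Box d}
    (hB : ∀ n j, 0 ≤ (B n).lower j ∧ (B n).lower j ≤ x j ∧ x j ≤ (B n).upper j
      ∧ (B n).upper j ≤ 1)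
    (hmin : ∀ᵐ ω ∂P, ∀ᶠ n in atTop, k n ≤ T.boxCount n (B n) (T.predictionData ω))
    (hbal : ∀ j, ∀ᵐ ω ∂P, Tendsto (fun n => T.stripCount j n (B n) (T.predictionData ω)
      / (T.nI n * T.meanWeight P n)) atTop (𝓝 0))
    (havg : ∀ q : ℚ, (q : ℝ) ∈ Set.Ioo (-c) c →
      (∀ᶠ n in atTop, IntegrableOn
        (fun z => (T.condMGF P κ n q z - 1) / T.meanWeight P n * f z) (B n).toSet) ∧
      Tendsto (fun n => 1 / (B n).vol * (∫ z in (B n).toSet,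
          (T.condMGF P κ n q z - 1) / T.meanWeight P n * f z)
        - (T.condMGF P κ n q x - 1) / T.meanWeight P n * f x) atTop (𝓝 0)) :
    ∀ᵐ ω ∂P, Tendsto (fun n => T.boxMean n (B n) (T.predictionData ω)) atTop
      (𝓝 (∫ y, y ∂(κ x))) := by
  have hkt := tendsto_leafSize hk
  have hkmean := eventually_leafSize_le_mean hh hw hc hmgf hkt hmin
  have hsum : Tendsto (fun n => T.nI n * T.meanWeight P n) atTop atTop :=
    tendsto_atTop_mono' _ hkmean (hkt.atTop_div_const two_pos)
  have hsq := eventually_mean_lt_sq_leafSize hd hh hw hsize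
  obtain ⟨K, hK0, hK⟩ := hcov.exists_sq_bound
  obtain ⟨M, hM⟩ := hw.bounded_mean
  have hM : ∀ n, T.meanWeight P n ≤ M := fun n => hM (Set.mem_range_self n)
  obtain ⟨q, hq0, hqc⟩ := exists_rat_btwn hc
  have hqm : (q : ℝ) ∈ Set.Ioo (-c) c := ⟨by linarith, hqc⟩
  obtain ⟨K₁, hK₁0, hK₁⟩ := exists_condMGF_bound hmgf hqm
  obtain ⟨hint1, hlim1⟩ := havg q hqm
  obtain ⟨hint2, hlim2⟩ := havg (-q) (by push_cast; exact ⟨by linarith, by linarith⟩)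
  push_cast at hint2 hlim2
  have hfx := hcov.density_pos hx
  set m := ∫ y, y ∂(κ x) with hm
  set E4 : ℕ → ℝ := fun n => ∫ ω, (T.WI n 0 ω - T.meanWeight P n) ^ 4 ∂P with hE4
  have hE40 : ∀ n, 0 ≤ E4 n := fun n => integral_nonneg fun ω => by positivity
  have hSI : ∀ n, (B n).toSet ⊆ Set.Icc 0 1 := fun n =>
    Box.toSet_subset_Icc fun j => ⟨(hB n j).1, (hB n j).2.2.2⟩
  have hBle : ∀ n j, (B n).lower j ≤ (B n).upper j := fun n j =>
    (hB n j).2.1.trans (hB n j).2.2.1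
  have hvol1 : ∀ n, (B n).vol ≤ 1 := fun n =>
    Finset.prod_le_one (fun j _ => sub_nonneg.2 (hBle n j)) fun j _ => by
      linarith [hB n j]
  have hdev : ∀ s : ℝ, (s = 1 ∨ s = -1) → ∀ l : ℕ, ∀ᵐ ω ∂P, ∀ᶠ n in atTop,
      ω ∉ {ω | k n ≤ T.boxCount n (B n) (T.predictionData ω) ∧
        0 ≤ ∑ i : Fin (T.nI n), T.WI n i ω * ((B n).toSet.indicator (fun _ => (1 : ℝ))
          (T.ZI i ω).1 * (s * ((T.ZI i ω).2 - m) - 1 / ((l : ℝ) + 1)))} := by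
    intro s hs l
    have hs2 : s * s = 1 := by rcases hs with rfl | rfl <;> norm_num
    set δ : ℝ := 1 / ((l : ℝ) + 1) with hδdef
    have hδ : 0 < δ := by positivity
    set b' : ℝ := |s * m + 3 * δ / 4| + 1 with hb'
    have hb'0 : 0 < b' := by positivity
    set C : ℝ := 2 * K + 2 * (s * m + 3 * δ / 4) ^ 2 + 1 with hC
    have hC0 : 0 < C := by positivity
    set c₃ : ℝ := (C / (δ / 2 * (δ / 4 / 8))) ^ 4 with hc₃
    have hc₃0 : 0 ≤ c₃ := by positivity
    have ha : 0 < (q : ℝ) * δ / 64 := by positivity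
    -- The four series bound, in order, jumps of `W Y`, jumps of `W`, and the contributions of `μ⁴`
    -- and of the centred fourth moments to the Chernoff term.
    have hsummable := (((summable_sq_div_cosh hkt hk ha).mul_left ((K₁ * f x + 1) / 4)).add
      (hsize.fourth.mul_left ((128 * b' / δ) ^ 4))).add
      ((hh.summable_inv_nI_sq.mul_left (c₃ * 8 * (M ^ 2 / 64))).add
        (hsize.fourth.mul_left (c₃ * 8)))
    have hnn1 : ∀ n, 0 ≤ (K₁ * f x + 1) / 4 *
        (k n ^ 2 / (2 * Real.cosh ((q : ℝ) * δ / 64 * k n) - 2)) := by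
      intro n
      have h1 := Real.one_le_cosh ((q : ℝ) * δ / 64 * k n)
      have h2 : 0 ≤ 2 * Real.cosh ((q : ℝ) * δ / 64 * k n) - 2 := by linarith
      positivity
    have hnn2 : ∀ n, ∀ a : ℝ, 0 ≤ a → 0 ≤ a * (E4 n / k n ^ 4 * T.nI n) := by
      intro n a h
      have := hE40 n
      positivity
    have hnn3 : ∀ n, 0 ≤ c₃ * 8 * (M ^ 2 / 64) * ((T.nI n : ℝ) ^ 2)⁻¹ := by
      intro n
      positivity
    have hnn4 : ∀ n, 0 ≤ c₃ * 8 * (E4 n / k n ^ 4 * T.nI n) := fun n =>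
      hnn2 n _ (by positivity)
    have hnn5 : ∀ n, 0 ≤ (128 * b' / δ) ^ 4 * (E4 n / k n ^ 4 * T.nI n) := fun n =>
      hnn2 n _ (by positivity)
    refine ae_eventually_notMem_of_le_ofReal hsummable
      (fun n => add_nonneg (add_nonneg (hnn1 n) (hnn5 n)) (add_nonneg (hnn3 n) (hnn4 n))) ?_
    filter_upwards [hkt.eventually_gt_atTop 0, hsum.eventually_gt_atTop 0, hint1, hint2,
      hlim1.eventually (gt_mem_nhds one_pos), hlim2.eventually (gt_mem_nhds one_pos),
      eventually_setIntegral_condMean_le hh hw hc hmgf hcov hB havg hx hsum hbal hs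
        (show 0 < δ / 4 by positivity),
      (hkt.const_mul_atTop (show 0 < δ / (64 * b') / 2 by positivity)).eventually_ge_atTop M, hsq]
      with n hn1 hn2 hn3 hn4 hn5 hn6 hn7 hn8 hn9
    have hN0 : (0 : ℝ) < T.nI n := by exact_mod_cast hh.nI_pos n
    have hμ : 0 < T.meanWeight P n := pos_of_mul_pos_right hn2 hN0.le
    have hvol0 : 0 ≤ (B n).vol := Box.vol_nonneg (hBle n)
    have hmain := measure_deviation_le hh hw hc hmgf hcov (hSI n) hs2 hδ hn1 hK0 hK hμ hqm hq0
      hn3 hn4 hn7 (hM n |>.trans (hn8.trans (le_of_eq (by rw [← hb']; ring))))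
    refine hmain.trans ?_
    rw [ENNReal.ofReal_add (add_nonneg (hnn1 n) (hnn5 n)) (add_nonneg (hnn3 n) (hnn4 n)),
      ENNReal.ofReal_add (hnn1 n) (hnn5 n)]
    refine add_le_add (add_le_add (ENNReal.ofReal_le_ofReal ?_) (ENNReal.ofReal_le_ofReal ?_))
      (ENNReal.ofReal_le_ofReal ?_)
    · set D := 2 * Real.cosh ((q : ℝ) * (δ * k n / 64)) - 2 with hD
      have hDeq : 2 * Real.cosh ((q : ℝ) * δ / 64 * k n) - 2 = D := by rw [hD]; ring_nf
      have hD0 : 0 ≤ D := by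
        have := Real.one_le_cosh ((q : ℝ) * (δ * k n / 64))
        linarith
      -- The averaged transform is within one of its value at `x`, and the volume is at most one.
      have hI : ∀ t : ℝ, 1 / (B n).vol * (∫ z in (B n).toSet,
          (T.condMGF P κ n t z - 1) / T.meanWeight P n * f z)
          - (T.condMGF P κ n t x - 1) / T.meanWeight P n * f x < 1 →
          (T.condMGF P κ n t x - 1) / T.meanWeight P n ≤ K₁ →
          ∫ z in (B n).toSet, (T.condMGF P κ n t z - 1) / T.meanWeight P n * f z
            ≤ K₁ * f x + 1 := by
        intro t h1 h2
        rw [Box.setIntegral_eq_vol_mul_average (hBle n)]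
        have h3 := mul_le_mul_of_nonneg_right h2 hfx.le
        have h4 : 1 / (B n).vol * (∫ z in (B n).toSet,
          (T.condMGF P κ n t z - 1) / T.meanWeight P n * f z) ≤ K₁ * f x + 1 := by linarith
        refine (mul_le_mul_of_nonneg_left h4 hvol0).trans ?_
        exact mul_le_of_le_one_left (by positivity) (hvol1 n)
      have h1 := add_le_add (hI q hn5 (hK₁ n).2.1) (hI (-q) hn6 (hK₁ n).2.2)
      rw [hDeq]
      calc _ ≤ (T.nI n : ℝ) * (T.meanWeight P n / D * (K₁ * f x + 1 + (K₁ * f x + 1))) := by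
            gcongr
        _ = (8 * T.nI n * T.meanWeight P n) / D * ((K₁ * f x + 1) / 4) := by ring
        _ ≤ k n ^ 2 / D * ((K₁ * f x + 1) / 4) := by gcongr
        _ = _ := by ring
    · refine le_of_eq ?_
      change T.nI n * ((2 / (δ * k n / (64 * b'))) ^ 4 * E4 n) = _
      field_simp
      ring
    -- Two factors of `μ` are bounded by `M`; the other two are paid for by `(8 nI μ)² ≤ k⁴`,
    -- leaving `nI ^ (-2)`, summable since `nI` is of order `n`.
    · have h1 : T.meanWeight P n ^ 4 / k n ^ 4 ≤ M ^ 2 / 64 * ((T.nI n : ℝ) ^ 2)⁻¹ := by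
        rw [← div_eq_mul_inv, div_div, div_le_div_iff₀ (by positivity) (by positivity)]
        have h2 : (8 * T.nI n * T.meanWeight P n) ^ 2 ≤ (k n ^ 2) ^ 2 := by gcongr
        have h3 : T.meanWeight P n ^ 2 ≤ M ^ 2 := by
          have := hM n
          gcongr
        calc T.meanWeight P n ^ 4 * (64 * (T.nI n : ℝ) ^ 2)
            = T.meanWeight P n ^ 2 * (8 * T.nI n * T.meanWeight P n) ^ 2 := by ring
          _ ≤ M ^ 2 * (k n ^ 2) ^ 2 := by gcongr
          _ = _ := by ring
      calc _ = c₃ * 8 * (T.meanWeight P n ^ 4 / k n ^ 4) + c₃ * 8 * (E4 n / k n ^ 4 * T.nI n) := by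
            simp only [hc₃, hE4]
            rw [← div_div, div_pow (C / (δ / 2 * (δ / 4 / 8))) (k n)]
            ring
        _ ≤ c₃ * 8 * (M ^ 2 / 64 * ((T.nI n : ℝ) ^ 2)⁻¹)
            + c₃ * 8 * (E4 n / k n ^ 4 * T.nI n) := by gcongr
        _ = _ := by ring
  filter_upwards [hmin, ae_all_iff.2 (hdev 1 (Or.inl rfl)), ae_all_iff.2 (hdev (-1) (Or.inr rfl))]
    with ω h1 h2 h3
  rw [Metric.tendsto_atTop']
  intro ε hε
  obtain ⟨l, hl⟩ := exists_nat_one_div_lt hε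
  obtain ⟨n₀, hn₀⟩ := eventually_atTop.1
    (h1.and ((h2 l).and ((h3 l).and (hkt.eventually_gt_atTop 0))))
  refine ⟨n₀, fun n hn => ?_⟩
  obtain ⟨e1, e2, e3, e4⟩ := hn₀ n hn.le
  simp only [not_and, not_le] at e2 e3
  have hpos := e4.trans_le e1
  have f1 := lt_of_sum_localized_neg hpos (e2 e1)
  have f2 := lt_of_sum_localized_neg hpos (e3 e1)
  rw [Real.dist_eq, abs_lt]
  constructor <;> linarith

end BootstrapTree

end HonestTree

theorem mainTheorem11 {Ω Θ : Type*} [MeasurableSpace Ω] [MeasurableSpace Θ]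
    (P : Measure Ω) [IsProbabilityMeasure P] {d : ℕ} (hd : 0 < d)
    (T : HonestTree.BootstrapTree Ω Θ d)
    (f : (Fin d → ℝ) → ℝ) (κ : Kernel (Fin d → ℝ) ℝ) [IsMarkovKernel κ]
    (k : ℕ → ℝ) (x : Fin d → ℝ) (hx : x ∈ Set.Icc (0 : Fin d → ℝ) 1)
    (hcov : HonestTree.CovariateAssumption f κ)
    (hhonest : T.Honest P f κ)
    (hweights : T.WeightAssumption P)
    -- minimal weighted leaf size
    (hmin : ∀ᵐ ω ∂P, ∀ᶠ n in atTop, k n ≤ T.leafCount x n ω)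
    -- balance condition
    (hbalance : ∀ j : Fin d, ∀ᵐ ω ∂P,
      Tendsto (fun n => T.sideCount x j n ω / (T.nI n * T.meanWeight P n)) atTop (𝓝 0))
    (hmoments : T.SummableAdjustedMoments P)
    (hsize : T.SummableLeafSize P k)
    (hk : ∀ δ : ℝ, 0 < δ → Summable (fun n => Real.exp (-δ * k n)))
    (hmgf : ∃ c : ℝ, 0 < c ∧ T.MGFAssumption P f κ x c) :
    ∀ᵐ ω ∂P, Tendsto (fun n => T.predict x n ω) atTop (𝓝 (∫ y, y ∂(κ x))) := by

  obtain ⟨c, hc, hmgf⟩ := hmgf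
  exact HonestTree.BootstrapTree.ae_tendsto_predict_of_forall_boxes hhonest hweights hx hmin
    hbalance hmgf fun B hB h1 h2 h3 => HonestTree.BootstrapTree.ae_tendsto_boxMean hd hx hcov
      hhonest hweights hsize hk hc hmgf hB h1 h2 h3
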